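/- Let $(M,\omega)$ be a compact symplectic manifold (without boundary) and $L\subset(M,\omega)$ a compact Lagrangian submanifold. Fix the following data. * A symplectomorphism $\psi:(V,\omega_{can})\to(U,\omega)$ from an open neighborhood $V$ of the zero section in $T^*L$, where $\omega_{can}=\sum_i dx_i\wedge dy_i$ in cotangent coordinates, onto an open neighborhood $U$ of $L$ in $M$, restricting to the identity on $L$ (the zero section being identified with $L$). * An open neighborhood $V'$ of the zero section with $\overline{V'}\subset V$ such that $V'$ is fiberwise convex and $U':=\psi(V')$ satisfies $\overline{U'}\subset U$. * A function $f\in C^\infty(M)$ with $f|_{\overline{U'}}\equiv1$ and $\operatorname{supp}(f)\subset U$. Let $\Gamma_{V'}(T^*L)$ be the set of smooth sections $\sigma$ of $T^*L$ with $\sigma(L)\subset V'$, and let $\mathcal U'$ be the set of submanifolds of $M$ of the form $L'=(\psi\circ\sigma)(L)$ with $\sigma\in\Gamma_{V'}(T^*L)$; the section $\sigma$ is uniquely determined by $L'$. Write $X_\sigma$ for the vertical, fiberwise constant vector field on $T^*L$ whose value at $\xi\in T^*_xL$ is $\frac{d}{ds}\big|_{s=0}(\xi+s\,\sigma(x))$,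 and let $\phi_{L'}$ be the time-$1$ flow of the vector field $X_{L'}:=f\,\psi_*X_\sigma$ on $M$ (extended by zero outside $U$). An isotopy $(\phi_t)_{t\in[0,1]}$ of $M$ is a family of diffeomorphisms of $M$, smooth in $(t,x)\in[0,1]\times M$, with $\phi_0=\mathrm{Id}$. Define: * $\mathcal D_{\mathcal U'}(\omega,L)$, the set of pairs $(\omega',L')$ with $\omega'$ a symplectic form on $M$ and $L'\in\mathcal U'$ Lagrangian in $(M,\omega')$, with $(\omega',L')\sim(\omega'',L'')$ iff there is an isotopy $(\phi_t)$ of $M$ with $\phi_1(L')=L''$, $\phi_1^*\omega''=\omega'$ and $\phi_t(L')\in\mathcal U'$ for all $t\in[0,1]$; * $\operatorname{Def}_L(\omega)$, the set of symplectic forms $\omega'$ on $M$ for which $L$ is Lagrangian, with $\omega'\sim\omega''$ iff there is an isotopy $(\rho_t)$ of $M$ with $\rho_1^*\omega''=\omega'$ and $\rho_t(L)=L$ for all $t\in[0,1]$. Then each $\phi_{L'}$, $L'\in\mathcal U'$, is a diffeomorphism of $M$ that is isotopic to the identity and satisfies $\phi_{L'}(L)=L'$; both relations $\sim$ are equivalence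 relations; and the map $$q:\mathcal D_{\mathcal U'}(\omega,L)\to\operatorname{Def}_L(\omega),\qquad q(\omega',L')=\phi_{L'}^*\omega',$$ is well defined and descends to a well-defined bijection $$\overline q:\ \mathcal D_{\mathcal U'}(\omega,L)/{\sim}\ \longrightarrow\ \operatorname{Def}_L(\omega)/{\sim},\qquad [(\omega',L')]\mapsto[\phi_{L'}^*\omega'].$$ -/

import Mathlib

open Set Bundle Manifold
open scoped Manifold ContDiff Topology

noncomputable section

namespace LagDeform

/-! ### Differential forms on boundaryless manifolds -/

section Forms

variable {E : Type*} [NormedAddCommGroup E] [NormedSpace ℝ E]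
  {H : Type*} [TopologicalSpace H]
  {E' : Type*} [NormedAddCommGroup E'] [NormedSpace ℝ E']
  {H' : Type*} [TopologicalSpace H']

/-- Fields of alternating `k`-forms on the tangent spaces of `M`; smoothness is a separate
predicate. -/
abbrev DiffForm (I : ModelWithCorners ℝ E H) (M : Type*) [TopologicalSpace M]
    [ChartedSpace H M] (k : ℕ) : Type _ :=
  ∀ x : M, TangentSpace I x [⋀^Fin k]→L[ℝ] ℝ

variable {I : ModelWithCorners ℝ E H} {M : Type*} [TopologicalSpace M] [ChartedSpace H M]
  {I' : ModelWithCorners ℝ E' H'} {N : Type*} [TopologicalSpace N] [ChartedSpace H' N]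
  {k : ℕ}

/-- The pullback `φ^* α`. -/
def DiffForm.pullback (φ : M → N) (α : DiffForm I' N k) : DiffForm I M k :=
  fun x => (α (φ x)).compContinuousLinearMap (mfderiv I I' φ x)

/-- The expression of `α` in the preferred chart at `x₀`, that is, the pullback of `α` by the
inverse of that chart, as a form on (an open subset of) the model vector space. -/
def DiffForm.inChart (α : DiffForm I M k) (x₀ : M) (y : E) : E [⋀^Fin k]→L[ℝ] ℝ :=
  (α ((extChartAt I x₀).symm y)).compContinuousLinearMap
    (mfderiv 𝓘(ℝ, E) I (extChartAt I x₀).symm y)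

/-- `α` is smooth: its expression in each chart is smooth. -/
def DiffForm.IsSmooth (α : DiffForm I M k) : Prop :=
  ∀ x₀ : M, ContDiffOn ℝ ∞ (α.inChart x₀) (extChartAt I x₀).target

/-- The exterior derivative, computed at `x` in the chart at `x`. -/
def DiffForm.d (α : DiffForm I M k) : DiffForm I M (k + 1) :=
  fun x => (extDeriv (α.inChart x) (extChartAt I x x)).compContinuousLinearMap
    (mfderiv I 𝓘(ℝ, E) (extChartAt I x) x)

end Forms

/-! ### Symplectic forms, isotopies and flows on a manifold modelled on `E` -/

section Manifolds

variable (E : Type*) [NormedAddCommGroup E] [NormedSpace ℝ E]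
  (M : Type*) [TopologicalSpace M] [ChartedSpace E M]

/-- Symplectic forms on `M`: smooth, closed and nondegenerate `2`-forms. -/
structure SymplecticForm where
  /-- The underlying `2`-form. -/
  form : DiffForm 𝓘(ℝ, E) M 2
  smooth : form.IsSmooth
  closed : form.d = 0
  nondegenerate : ∀ (x : M) (v : TangentSpace 𝓘(ℝ, E) x), (∀ w, form x ![v, w] = 0) → v = 0

variable {E M}

/-- `(φ_t)_{t ∈ [0,1]}` is an isotopy of `M`: a family of diffeomorphisms, smooth in
`(t, x) ∈ [0,1] × M`, that starts at the identity. Values at `t ∉ [0,1]` are irrelevant. -/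
structure IsIsotopy (φ : ℝ → (M ≃ₘ^∞⟮𝓘(ℝ, E), 𝓘(ℝ, E)⟯ M)) : Prop where
  smooth : ContMDiffOn (𝓘(ℝ, ℝ).prod 𝓘(ℝ, E)) 𝓘(ℝ, E) ∞
    (fun p : ℝ × M => φ p.1 p.2) (Icc (0 : ℝ) 1 ×ˢ univ)
  zero : ∀ x, φ 0 x = x

/-- `φ` is the flow at time `1` of the vector field `X`: each point `x` is carried to `γ 1`, where
`γ` is an integral curve of `X`, defined for all times, with `γ 0 = x`. -/
def IsTimeOneFlow (X : ∀ x : M, TangentSpace 𝓘(ℝ, E) x) (φ : M → M) : Prop :=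
  ∀ x, ∃ γ : ℝ → M, γ 0 = x ∧ IsMIntegralCurve (I := 𝓘(ℝ, E)) γ X ∧ γ 1 = φ x

open Classical in
/-- The flow at time `1` of a vector field (the identity at points through which there is no
integral curve defined for all times; this does not happen for a smooth vector field on a
compact manifold). -/
def timeOneFlow (X : ∀ x : M, TangentSpace 𝓘(ℝ, E) x) (x : M) : M :=
  if h : ∃ γ : ℝ → M, γ 0 = x ∧ IsMIntegralCurve (I := 𝓘(ℝ, E)) γ X then h.choose 1 else x

variable {F : Type*} [NormedAddCommGroup F] [NormedSpace ℝ F]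
  {L : Type*} [TopologicalSpace L] [ChartedSpace F L]

/-- `j : L → M` is a Lagrangian embedding in `(M, Ω)`: a smooth embedding such that each tangent
space `dj (T_x L)` is equal to its own `Ω`-orthogonal. -/
structure IsLagrangianEmbedding (Ω : SymplecticForm E M) (j : L → M) : Prop where
  embedding : IsSmoothEmbedding 𝓘(ℝ, F) 𝓘(ℝ, E) ∞ j
  lagrangian : ∀ (x : L) (v : TangentSpace 𝓘(ℝ, E) (j x)),
    v ∈ range (mfderiv 𝓘(ℝ, F) 𝓘(ℝ, E) j x) ↔
      ∀ w : TangentSpace 𝓘(ℝ, F) x, Ω.form (j x) ![v, mfderiv 𝓘(ℝ, F) 𝓘(ℝ, E) j x w] = 0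

variable (F L) in
/-- `S ⊆ M` is a Lagrangian submanifold of `(M, Ω)` diffeomorphic to `L`. -/
def IsLagrangianSubmanifold (Ω : SymplecticForm E M) (S : Set M) : Prop :=
  ∃ j : L → M, IsLagrangianEmbedding (F := F) Ω j ∧ range j = S

end Manifolds

/-! ### The cotangent bundle -/

section Cotangent

variable (F : Type*) [NormedAddCommGroup F] [NormedSpace ℝ F]
  (L : Type*) [TopologicalSpace L] [ChartedSpace F L] [IsManifold 𝓘(ℝ, F) ∞ L]

/-- The cotangent bundle `T^*L`. -/
abbrev Cotangent : Type _ :=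
  TotalSpace (F →L[ℝ] ℝ) (fun x : L => TangentSpace 𝓘(ℝ, F) x →L[ℝ] ℝ)

/-- The model of `T^*L` as a manifold. -/
abbrev cotangentModel : ModelWithCorners ℝ (F × (F →L[ℝ] ℝ)) (ModelProd F (F →L[ℝ] ℝ)) :=
  𝓘(ℝ, F).prod 𝓘(ℝ, F →L[ℝ] ℝ)

/-- Smooth sections of `T^*L`, that is, smooth `1`-forms on `L`. -/
abbrev OneForm : Type _ :=
  ContMDiffSection 𝓘(ℝ, F) (F →L[ℝ] ℝ) ∞ (fun x : L => TangentSpace 𝓘(ℝ, F) x →L[ℝ] ℝ)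

variable {F L}

/-- A section of `T^*L` as a map `L → T^*L`. -/
def OneForm.toMap (σ : OneForm F L) (x : L) : Cotangent F L := ⟨x, σ x⟩

/-- The tautological `1`-form `θ` on `T^*L`: `θ_ξ (v) = ξ (dp (v))`, where `p : T^*L → L`
(in cotangent coordinates `θ = ∑ y_i dx_i`). -/
def tautologicalForm : DiffForm (cotangentModel F) (Cotangent F L) 1 :=
  fun ξ => ContinuousAlternatingMap.ofSubsingleton ℝ
    (TangentSpace (cotangentModel F) ξ) ℝ (0 : Fin 1)
    (ξ.2.comp (mfderiv (cotangentModel F) 𝓘(ℝ, F)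
      (fun η : Cotangent F L => η.1) ξ))

/-- The canonical symplectic form `ω_can = -dθ` on `T^*L`
(in cotangent coordinates `ω_can = ∑ dx_i ∧ dy_i`). -/
def canonicalForm : DiffForm (cotangentModel F) (Cotangent F L) 2 :=
  fun ξ => -(tautologicalForm (F := F) (L := L)).d ξ

/-- The vertical, fiberwise constant vector field `X_σ` on `T^*L` given by a section `σ`: its value
at `ξ ∈ T_x^*L` is the velocity at `s = 0` of the curve `s ↦ ξ + s σ(x)`. -/
def verticalField (σ : OneForm F L) (ξ : Cotangent F L) : TangentSpace (cotangentModel F) ξ :=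
  mfderiv 𝓘(ℝ, ℝ) (cotangentModel F)
    (fun s : ℝ => (⟨ξ.1, ξ.2 + s • σ ξ.1⟩ : Cotangent F L)) 0 (1 : ℝ)

end Cotangent

/-! ### Lagrangian neighborhoods and the two moduli spaces -/

section Moduli

variable {E : Type*} [NormedAddCommGroup E] [NormedSpace ℝ E]
  {M : Type*} [TopologicalSpace M] [ChartedSpace E M]
  {F : Type*} [NormedAddCommGroup F] [NormedSpace ℝ F]
  {L : Type*} [TopologicalSpace L] [ChartedSpace F L] [IsManifold 𝓘(ℝ, F) ∞ L]

/-- The auxiliary data fixed around the Lagrangian submanifold `L` (embedded by `ι`) of `(M, Ω)`. -/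
structure LagrangianNeighborhood (Ω : SymplecticForm E M) (ι : L → M) where
  /-- A diffeomorphism `ψ` from an open set `V = ψ.source` of `T^*L` onto an open set
  `U = ψ.target` of `M`. -/
  ψ : PartialDiffeomorph (cotangentModel F) 𝓘(ℝ, E) (Cotangent F L) M ∞
  /-- `V` contains the zero section, and `ψ` restricts to the identity on `L`. -/
  zero_mem : ∀ x : L, (⟨x, 0⟩ : Cotangent F L) ∈ ψ.source
  ψ_zero : ∀ x : L, ψ (⟨x, 0⟩ : Cotangent F L) = ι x
  /-- `ψ : (V, ω_can) → (U, Ω)` is a symplectomorphism. -/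
  symplectic : ∀ ξ ∈ ψ.source, DiffForm.pullback (I := cotangentModel F) ψ Ω.form ξ =
    canonicalForm ξ
  /-- The smaller neighborhood `V'` of `L` in `T^*L`; the smaller neighborhood `U'` of `L` in `M`
  is `ψ(V')`. -/
  V' : Set (Cotangent F L)
  isOpen_V' : IsOpen V'
  zero_mem_V' : ∀ x : L, (⟨x, 0⟩ : Cotangent F L) ∈ V'
  closure_V' : closure V' ⊆ ψ.source
  closure_U' : closure (ψ '' V') ⊆ ψ.target
  fiberwise_convex : ∀ x : L,
    Convex ℝ {ξ : TangentSpace 𝓘(ℝ, F) x →L[ℝ] ℝ | (⟨x, ξ⟩ : Cotangent F L) ∈ V'}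
  /-- The cut-off function. -/
  f : M → ℝ
  f_smooth : ContMDiff 𝓘(ℝ, E) 𝓘(ℝ, ℝ) ∞ f
  f_one : ∀ x ∈ closure (ψ '' V'), f x = 1
  f_supp : tsupport f ⊆ ψ.target

namespace LagrangianNeighborhood

variable {Ω : SymplecticForm E M} {ι : L → M} (𝒩 : LagrangianNeighborhood (F := F) Ω ι)

/-- `σ ∈ Γ_{V'}(T^*L)`, and `S` is the image of `ψ ∘ σ : L → M`. -/
def Represents (σ : OneForm F L) (S : Set M) : Prop :=
  (∀ x, σ.toMap x ∈ 𝒩.V') ∧ range (fun x => 𝒩.ψ (σ.toMap x)) = S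

/-- The chart domain `𝒰'` of the non-linear Grassmannian: the images of `ψ ∘ σ` for
`σ ∈ Γ_{V'}(T^*L)`. -/
def chartNhd : Set (Set M) := {S | ∃ σ : OneForm F L, 𝒩.Represents σ S}

/-- The section `σ ∈ Γ_{V'}(T^*L)` representing `L' ∈ 𝒰'`. -/
def sectionOf (L' : 𝒩.chartNhd) : OneForm F L := L'.2.choose

/-- The vector field `X_{L'} = f ψ_* X_σ`, extended by zero outside `U`. -/
def field (L' : 𝒩.chartNhd) (x : M) : TangentSpace 𝓘(ℝ, E) x :=
  𝒩.f x • (mfderiv (cotangentModel F) 𝓘(ℝ, E) 𝒩.ψ (𝒩.ψ.symm x)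
    (verticalField (𝒩.sectionOf L') (𝒩.ψ.symm x)) : E)

/-- `φ_{L'}`, the time-`1` flow of `X_{L'}`. -/
def phi (L' : 𝒩.chartNhd) : M → M := timeOneFlow (𝒩.field L')

/-- The space `𝒟_{𝒰'}(ω, L)` of pairs `(ω', L')`. -/
structure Pairs where
  form : SymplecticForm E M
  sub : 𝒩.chartNhd
  lagrangian : IsLagrangianSubmanifold F L form (sub : Set M)

/-- Equivalence of pairs: isotopies that keep `L'` in `𝒰'`. -/
def Pairs.Equiv (p p' : 𝒩.Pairs) : Prop :=
  ∃ φ : ℝ → (M ≃ₘ^∞⟮𝓘(ℝ, E), 𝓘(ℝ, E)⟯ M), IsIsotopy φ ∧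
    φ 1 '' (p.sub : Set M) = p'.sub ∧
    DiffForm.pullback (φ 1) p'.form.form = p.form.form ∧
    ∀ t ∈ Icc (0 : ℝ) 1, φ t '' (p.sub : Set M) ∈ 𝒩.chartNhd

end LagrangianNeighborhood

variable (E F) in
/-- The space `Def_L(ω)` of symplectic forms for which the submanifold `L = ι(L)` is Lagrangian. -/
structure DefL (ι : L → M) where
  form : SymplecticForm E M
  lagrangian : IsLagrangianSubmanifold F L form (range ι)

/-- Equivalence in `Def_L(ω)`: isotopies that preserve `L`. -/
def DefL.Equiv {ι : L → M} (η η' : DefL E F ι) : Prop :=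
  ∃ ρ : ℝ → (M ≃ₘ^∞⟮𝓘(ℝ, E), 𝓘(ℝ, E)⟯ M), IsIsotopy ρ ∧
    DiffForm.pullback (ρ 1) η'.form.form = η.form.form ∧
    ∀ t ∈ Icc (0 : ℝ) 1, ρ t '' range ι = range ι

end Moduli

end LagDeform

end

/-!
Everything rests on an explicit description of the flow. The field `f ψ_* X_σ` is carried by `ψ`
from a field on `T^*L` that is tangent to the fibers and, along a line `ξ + ℝ σ(x)` in the fiber
over `x`, a multiple of the constant vector `σ(x)`. Its flow lines are therefore
`t ↦ ξ + u(t) σ(x)`, where `u` solves the scalar equation `u' = f(ψ(ξ + u σ(x)))`, `u(0) = 0`. Since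
`f ∘ ψ`, extended by zero outside `V`, is smooth and bounded, solutions exist for all times
(`LagrangianNeighborhood.fiberTime`). They depend smoothly on all data (`contMDiff_scalar_ode`):
this is the implicit function theorem in `C([0, 1])`, where `u ↦ g ∘ u` is a smooth map
(`contDiff_superposition`). Hence the time-`1` flow is a diffeomorphism whose inverse is the flow of
`-σ`, it depends smoothly on `σ` (`LagrangianNeighborhood.contMDiff_flowMap`), and it maps `L` onto
the image of `ψ ∘ σ`: as `V'` is fiberwise convex, the segment from `0` to `σ(x)` lies in `V'`,
where `f ∘ ψ = 1`, so the flow line of `0` is `t ↦ t σ(x)` for `t ∈ [0, 1]`.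

The bijection of quotients is conjugation of isotopies by these flows.
* An isotopy `φ_t` that moves `L'` through `𝒰'` gives `φ_{L_t}⁻¹ ∘ φ_t ∘ φ_{L'}` with
  `L_t = φ_t(L')`, which preserves `L`. It is smooth because the sections that represent `L_t` form
  a smooth family (`LagrangianNeighborhood.Represents.contMDiff_family`, by the inverse function
  theorem).
* An isotopy `ρ_t` that preserves `L` gives `φ_{L_t} ∘ ρ_t ∘ φ_{L'}⁻¹`, where `L_t` is the image of
  `(1 - t) σ' + t σ''`; here fiberwise convexity of `V'` keeps `L_t` in `𝒰'`.

So `q` preserves and reflects equivalence. It is surjective because the flow that belongs to the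
zero section, hence to `L` itself, is the identity.
-/

noncomputable section

namespace LagDeform

/-! ### Superposition operators on spaces of continuous functions -/

section Superposition

universe u w

/-- A bounded bilinear operation `Z × V → W`, applied pointwise to continuous functions. -/
def pointwiseBilinear (K : Type*) {Z V W : Type*} [TopologicalSpace K] [CompactSpace K]
    [NormedAddCommGroup Z] [NormedSpace ℝ Z]
    [NormedAddCommGroup V] [NormedSpace ℝ V] [NormedAddCommGroup W] [NormedSpace ℝ W]
    (B : Z →L[ℝ] V →L[ℝ] W) : C(K, Z) →L[ℝ] C(K, V) →L[ℝ] C(K, W) :=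
  LinearMap.mkContinuous₂
    (LinearMap.mk₂ ℝ (fun (A : C(K, Z)) (h : C(K, V)) =>
      (⟨fun x => B (A x) (h x), by fun_prop⟩ : C(K, W)))
      (fun _ _ _ => by ext; simp) (fun _ _ _ => by ext; simp)
      (fun _ _ _ => by ext; simp) (fun _ _ _ => by ext; simp)) ‖B‖
    (fun A h => by
      rw [ContinuousMap.norm_le _ (by positivity)]
      exact fun x => (B.le_opNorm₂ (A x) (h x)).trans (by
        gcongr
        exacts [A.norm_coe_le_norm x, h.norm_coe_le_norm x]))

variable {K : Type*} [TopologicalSpace K] [CompactSpace K]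
  {V : Type*} [NormedAddCommGroup V] [NormedSpace ℝ V]

theorem pointwiseBilinear_apply {Z W : Type*} [NormedAddCommGroup Z] [NormedSpace ℝ Z]
    [NormedAddCommGroup W] [NormedSpace ℝ W] (B : Z →L[ℝ] V →L[ℝ] W)
    (A : C(K, Z)) (h : C(K, V)) (x : K) : pointwiseBilinear K B A h x = B (A x) (h x) := rfl

/-- The derivative of `u ↦ g ∘ u` is `h ↦ (x ↦ Dg(u(x)) h(x))`, where `Dg = B ∘ g'`. -/
theorem hasFDerivAt_superposition {Z W : Type*} [NormedAddCommGroup Z] [NormedSpace ℝ Z]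
    [NormedAddCommGroup W] [NormedSpace ℝ W] (B : Z →L[ℝ] V →L[ℝ] W)
    (g : C(V, W)) (g' : C(V, Z))
    (hg : ∀ v, HasFDerivAt g (B (g' v)) v) (u : C(K, V)) :
    HasFDerivAt (fun u : C(K, V) => g.comp u) (pointwiseBilinear K B (g'.comp u)) u := by
  rw [hasFDerivAt_iff_isLittleO_nhds_zero, Asymptotics.isLittleO_iff]
  intro c hc
  have hcont : ContinuousAt (fun u : C(K, V) => g'.comp u) u :=
    (ContinuousMap.continuous_postcomp g').continuousAt
  obtain ⟨δ, hδ, H⟩ := Metric.continuousAt_iff.1 hcont (c / (‖B‖ + 1)) (by positivity)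
  filter_upwards [Metric.ball_mem_nhds (0 : C(K, V)) hδ] with h hh
  rw [mem_ball_zero_iff] at hh
  rw [ContinuousMap.norm_le _ (by positivity)]
  intro x
  -- Perturbing `u` by constants bounds `g' - g' (u x)` on a whole ball around `u x`.
  have hbound : ∀ v ∈ Metric.ball (u x) δ, ‖B (g' v) - B (g' (u x))‖ ≤ c := by
    intro v hv
    have h1 : dist (u + ContinuousMap.const K (v - u x)) u < δ := by
      rw [dist_eq_norm, add_sub_cancel_left]
      refine lt_of_le_of_lt ((ContinuousMap.norm_le _ (norm_nonneg (v - u x))).2 fun y => ?_)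
        (by simpa [dist_eq_norm] using hv)
      simp
    have h2 := (ContinuousMap.dist_apply_le_dist
      (f := g'.comp (u + ContinuousMap.const K (v - u x))) (g := g'.comp u) x).trans (H h1).le
    have h3 : ‖g' v - g' (u x)‖ ≤ c / (‖B‖ + 1) := by simpa [dist_eq_norm] using h2
    rw [← map_sub]
    calc ‖B (g' v - g' (u x))‖ ≤ ‖B‖ * (c / (‖B‖ + 1)) := B.le_opNorm_of_le h3
      _ ≤ (‖B‖ + 1) * (c / (‖B‖ + 1)) := by gcongr; linarith
      _ = c := by field_simp
  have hmv := (convex_ball (u x) δ).norm_image_sub_le_of_norm_hasFDerivWithin_le'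
    (f := g) (f' := fun v => B (g' v)) (φ := B (g' (u x))) (C := c)
    (fun v _ => (hg v).hasFDerivWithinAt) hbound
    (Metric.mem_ball_self hδ) (y := u x + h x)
    (by simpa using lt_of_le_of_lt (h.norm_coe_le_norm x) hh)
  simp only [add_sub_cancel_left] at hmv
  refine le_trans ?_ (hmv.trans (mul_le_mul_of_nonneg_left (h.norm_coe_le_norm x) hc.le))
  simp [pointwiseBilinear_apply]

theorem contDiff_superposition_succ {Z W : Type*} [NormedAddCommGroup Z] [NormedSpace ℝ Z]
    [NormedAddCommGroup W] [NormedSpace ℝ W] (B : Z →L[ℝ] V →L[ℝ] W)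
    (g : C(V, W)) (g' : C(V, Z)) (hg : ∀ v, HasFDerivAt g (B (g' v)) v) (n : ℕ)
    (h : ContDiff ℝ n (fun u : C(K, V) => g'.comp u)) :
    ContDiff ℝ (n + 1) (fun u : C(K, V) => g.comp u) := by
  rw [contDiff_succ_iff_hasFDerivAt]
  exact ⟨_, (pointwiseBilinear K B).contDiff.comp h, hasFDerivAt_superposition B g g' hg⟩

/-- The induction passes from the target `W` to `V →L[ℝ] W`, so `W` has to live in a universe that
contains that of `V`. -/
theorem contDiff_superposition_nat {V : Type u} [NormedAddCommGroup V] [NormedSpace ℝ V] (n : ℕ) :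
    ∀ {W : Type (max u w)} [NormedAddCommGroup W] [NormedSpace ℝ W] (g : C(V, W)), ContDiff ℝ n g →
      ContDiff ℝ n (fun u : C(K, V) => g.comp u) := by
  induction n with
  | zero =>
    intro W _ _ g _
    exact contDiff_zero.2 (ContinuousMap.continuous_postcomp g)
  | succ n IH =>
    intro W _ _ g hg
    have hg1 := contDiff_succ_iff_fderiv.1 (by exact_mod_cast hg : ContDiff ℝ (n + 1) g)
    have hc : Continuous (fderiv ℝ g) := hg1.2.2.continuous
    exact_mod_cast contDiff_superposition_succ (Z := V →L[ℝ] W) (ContinuousLinearMap.id ℝ _) g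
      ⟨fderiv ℝ g, hc⟩ (fun v => (hg1.1 v).hasFDerivAt) n (IH ⟨fderiv ℝ g, hc⟩ hg1.2.2)

/-- A smooth map between normed spaces acts smoothly on continuous functions by composition. -/
theorem contDiff_superposition {V : Type u} [NormedAddCommGroup V] [NormedSpace ℝ V]
    {W : Type w} [NormedAddCommGroup W] [NormedSpace ℝ W] (g : C(V, W)) (hg : ContDiff ℝ ∞ g) :
    ContDiff ℝ ∞ (fun u : C(K, V) => g.comp u) := by
  rw [contDiff_infty]
  intro n
  -- The target is lifted to the universe in which the induction runs.
  let e : ULift.{max u w} W ≃L[ℝ] W := ContinuousLinearEquiv.ulift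
  let g₁ : C(V, ULift.{max u w} W) := ⟨fun v => e.symm (g v), by fun_prop⟩
  have h₁ : ContDiff ℝ n g₁ := e.symm.contDiff.comp (hg.of_le (by exact_mod_cast le_top))
  exact ((e : ULift.{max u w} W →L[ℝ] W).compLeftContinuous ℝ K).contDiff.comp
    (contDiff_superposition_nat.{u, w} (K := K) n g₁ h₁)

end Superposition

/-! ### Smooth dependence of scalar differential equations on parameters -/

section ScalarODE

open MeasureTheory intervalIntegral

/-- Integration from `0`, as an operator on `C([0, 1])`. -/
def volterra : C(unitInterval, ℝ) →L[ℝ] C(unitInterval, ℝ) :=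
  LinearMap.mkContinuous
    { toFun := fun h => ⟨fun t => ∫ r in (0 : ℝ)..t, IccExtend zero_le_one h r, by
        have hc : Continuous (IccExtend (zero_le_one (α := ℝ)) h) := h.continuous.Icc_extend'
        exact (continuous_primitive (fun a b => hc.intervalIntegrable a b) 0).comp
          continuous_subtype_val⟩
      map_add' := fun h k => by
        ext t
        have hc : Continuous (IccExtend (zero_le_one (α := ℝ)) h) := h.continuous.Icc_extend'
        have kc : Continuous (IccExtend (zero_le_one (α := ℝ)) k) := k.continuous.Icc_extend'
        exact integral_add (hc.intervalIntegrable _ _) (kc.intervalIntegrable _ _)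
      map_smul' := fun c h => by
        ext t
        exact integral_const_mul c _ } 1
    (fun h => by
      rw [one_mul, ContinuousMap.norm_le _ (norm_nonneg _)]
      intro t
      refine (intervalIntegral.norm_integral_le_of_norm_le_const (C := ‖h‖) fun r _ => ?_).trans ?_
      · exact h.norm_coe_le_norm _
      · rw [sub_zero, abs_of_nonneg t.2.1]
        exact mul_le_of_le_one_right (norm_nonneg _) t.2.2)

theorem volterra_apply (h : C(unitInterval, ℝ)) (t : unitInterval) :
    volterra h t = ∫ r in (0 : ℝ)..t, IccExtend zero_le_one h r := rfl

theorem hasDerivAt_integral_IccExtend (h : C(unitInterval, ℝ)) (t : ℝ) :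
    HasDerivAt (fun t => ∫ r in (0 : ℝ)..t, IccExtend zero_le_one h r)
      (IccExtend zero_le_one h t) t :=
  have hc : Continuous (IccExtend (zero_le_one (α := ℝ)) h) := h.continuous.Icc_extend'
  integral_hasDerivAt_right (hc.intervalIntegrable _ _) (hc.stronglyMeasurableAtFilter _ _)
    hc.continuousAt

/-- A differentiable function on `[0, 1]` that vanishes at `0` is the integral of its derivative. -/
theorem eq_volterra_of_hasDerivAt {y : ℝ → ℝ} {k : C(unitInterval, ℝ)} (h0 : y 0 = 0)
    (h : ∀ t : unitInterval, HasDerivAt y (k t) t) (t : unitInterval) :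
    y t = volterra k t := by
  rw [volterra_apply, integral_eq_sub_of_hasDerivAt (f := y), h0, sub_zero]
  · intro r hr
    rw [uIcc_of_le t.2.1] at hr
    have hr' : r ∈ Icc (0 : ℝ) 1 := ⟨hr.1, hr.2.trans t.2.2⟩
    rw [IccExtend_of_mem _ _ hr']
    exact h ⟨r, hr'⟩
  · exact (k.continuous.Icc_extend').intervalIntegrable _ _

/-- The linearised equation `h - ∫ a h = k` is uniquely solvable. -/
theorem bijective_sub_volterra_mul (a : C(unitInterval, ℝ)) :
    Function.Bijective (fun h : C(unitInterval, ℝ) => h - volterra (a * h)) := by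
  set A : ℝ → ℝ := fun t => ∫ r in (0 : ℝ)..t, IccExtend zero_le_one a r with hA
  have hAd : ∀ t, HasDerivAt A (IccExtend zero_le_one a t) t := hasDerivAt_integral_IccExtend a
  have hAc : Continuous A := continuous_iff_continuousAt.2 fun t => (hAd t).continuousAt
  -- Both parts use the integrating factor `exp (-A)`, where `A` is the primitive of `a`.
  constructor
  · intro h₁ h₂ h
    obtain ⟨d, hd⟩ : ∃ d, d = h₁ - h₂ := ⟨_, rfl⟩
    have e : d = volterra (a * d) := by
      have : h₁ - h₂ = volterra (a * h₁) - volterra (a * h₂) := by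
        have h' : h₁ - volterra (a * h₁) = h₂ - volterra (a * h₂) := h
        rw [sub_eq_sub_iff_add_eq_add] at h' ⊢
        rw [h', add_comm]
      rw [hd, mul_sub, map_sub, ← this]
    -- The function `exp (-A) ∫ a d` has derivative zero.
    have hD := hasDerivAt_integral_IccExtend (a * d)
    have hz : ∀ t : unitInterval, d t = 0 := by
      intro t
      have hconst := constant_of_has_deriv_right_zero (a := (0 : ℝ)) (b := 1)
        (f := fun t => Real.exp (-A t) * ∫ r in (0 : ℝ)..t, IccExtend zero_le_one (a * d) r)
        (fun t _ => ((hAd t).neg.exp.mul (hD t)).continuousAt.continuousWithinAt)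
        (fun t ht => by
          have ht' : t ∈ Icc (0 : ℝ) 1 := ⟨ht.1, ht.2.le⟩
          have h1 : IccExtend zero_le_one (⇑(a * d)) t = IccExtend zero_le_one a t *
              ∫ r in (0 : ℝ)..t, IccExtend zero_le_one (a * d) r := by
            rw [IccExtend_of_mem _ _ ht', IccExtend_of_mem _ _ ht', ContinuousMap.mul_apply]
            congr 1
            conv_lhs => rw [e]
            rfl
          refine (((hAd t).neg.exp.mul (hD t)).congr_deriv ?_).hasDerivWithinAt
          rw [h1]
          ring)
        t t.2
      simp only [integral_same, mul_zero, mul_eq_zero, (Real.exp_pos _).ne', false_or] at hconst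
      rw [e]
      exact hconst
    exact sub_eq_zero.1 (hd ▸ ContinuousMap.ext hz)
  · intro k
    -- The solution is `k + y`, where `y' = a (k + y)` and `y(0) = 0`.
    let b : C(unitInterval, ℝ) := ⟨fun t => Real.exp (-A t) * (a t * k t), by fun_prop⟩
    let y : ℝ → ℝ := fun t => Real.exp (A t) * ∫ r in (0 : ℝ)..t, IccExtend zero_le_one b r
    have hy : ∀ t, HasDerivAt y (IccExtend zero_le_one a t * y t +
        Real.exp (A t) * IccExtend zero_le_one b t) t := fun t =>
      ((hAd t).exp.mul (hasDerivAt_integral_IccExtend b t)).congr_deriv (by simp only [y]; ring)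
    have hyc : Continuous y := continuous_iff_continuousAt.2 fun t => (hy t).continuousAt
    let h : C(unitInterval, ℝ) := ⟨fun t => k t + y t, by fun_prop⟩
    refine ⟨h, ?_⟩
    ext t
    have := eq_volterra_of_hasDerivAt (y := y) (k := a * h) (by simp [y]) (fun t => by
      refine (hy t).congr_deriv ?_
      rw [IccExtend_of_mem _ _ t.2, IccExtend_of_mem _ _ t.2]
      simp only [b, h, ContinuousMap.mul_apply, ContinuousMap.coe_mk, Subtype.coe_eta]
      rw [← mul_assoc (Real.exp (A t)), ← Real.exp_add, add_neg_cancel, Real.exp_zero]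
      ring) t
    simp only [ContinuousMap.sub_apply, ← this]
    simp [h]

/-- Two solutions of a scalar equation with `C¹` right-hand side and the same initial value
agree. -/
theorem eqOn_of_scalar_ode {g : ℝ → ℝ} (hg : ContDiff ℝ 1 g) {u v : ℝ → ℝ}
    (hu : ∀ t ∈ Icc (0 : ℝ) 1, HasDerivWithinAt u (g (u t)) (Icc 0 1) t)
    (hv : ∀ t ∈ Icc (0 : ℝ) 1, HasDerivWithinAt v (g (v t)) (Icc 0 1) t)
    (h0 : u 0 = v 0) : EqOn u v (Icc 0 1) := by
  have huc : ContinuousOn u (Icc 0 1) := fun t ht => (hu t ht).continuousWithinAt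
  have hvc : ContinuousOn v (Icc 0 1) := fun t ht => (hv t ht).continuousWithinAt
  obtain ⟨R, hR⟩ := ((isCompact_Icc.image_of_continuousOn huc).union
    (isCompact_Icc.image_of_continuousOn hvc)).isBounded.subset_closedBall 0
  obtain ⟨C, hC⟩ := (hg.contDiffOn (s := Metric.closedBall (0 : ℝ) R)).exists_lipschitzOnWith
    one_ne_zero (convex_closedBall 0 R) (isCompact_closedBall 0 R)
  exact ODE_solution_unique_of_mem_Icc_right (v := fun _ => g)
    (s := fun _ => Metric.closedBall (0 : ℝ) R) (K := C) (fun _ _ => hC) huc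
    (fun t ht => (hu t ⟨ht.1, ht.2.le⟩).mono_of_mem_nhdsWithin (Icc_mem_nhdsGE_of_mem ht))
    (fun t ht => hR (.inl ⟨t, ⟨ht.1, ht.2.le⟩, rfl⟩)) hvc
    (fun t ht => (hv t ⟨ht.1, ht.2.le⟩).mono_of_mem_nhdsWithin (Icc_mem_nhdsGE_of_mem ht))
    (fun t ht => hR (.inr ⟨t, ⟨ht.1, ht.2.le⟩, rfl⟩)) h0

/-- **Smooth dependence on parameters** of the solutions of a scalar differential equation. The
solution is the implicit function defined by `u - ∫ g (p, u) = 0` in `C([0, 1])`. -/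
theorem contDiffAt_scalar_ode {P : Type*} [NormedAddCommGroup P] [NormedSpace ℝ P]
    [CompleteSpace P] {g : P × ℝ → ℝ} (hg : ContDiff ℝ ∞ g) {s : P → ℝ → ℝ} {p₀ : P}
    (h0 : ∀ᶠ p in 𝓝 p₀, s p 0 = 0)
    (hs : ∀ᶠ p in 𝓝 p₀, ∀ t ∈ Icc (0 : ℝ) 1, HasDerivAt (s p) (g (p, s p t)) t) :
    ContDiffAt ℝ ∞ (fun p => s p 1) p₀ := by
  let X := C(unitInterval, ℝ)
  let gc : C(P × ℝ, ℝ) := ⟨g, hg.continuous⟩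
  -- the pair of functions `(p, u)`, as a continuous function on `[0, 1]`
  let pair : P × X → C(unitInterval, P × ℝ) := fun z =>
    (ContinuousMap.const unitInterval z.1).prodMk z.2
  let pairL : P × X →L[ℝ] C(unitInterval, P × ℝ) := LinearMap.mkContinuous
    { toFun := pair
      map_add' := fun _ _ => rfl
      map_smul' := fun _ _ => rfl } 1 (fun z => by
        rw [one_mul, ContinuousMap.norm_le _ (norm_nonneg _)]
        intro t
        exact max_le_max le_rfl (z.2.norm_coe_le_norm t))
  let Ψ : P × X → P × X := fun z => (z.1, z.2 - volterra (gc.comp (pair z)))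
  have hΨ : ContDiff ℝ ∞ Ψ := contDiff_fst.prodMk (contDiff_snd.sub
    (volterra.contDiff.comp ((contDiff_superposition gc hg).comp pairL.contDiff)))
  have hode0 := hs.self_of_nhds
  let u₀ : X := ⟨fun t => s p₀ t, continuous_iff_continuousAt.2 fun t =>
    ((hode0 t t.2).continuousAt).comp continuous_subtype_val.continuousAt⟩
  let z₀ : P × X := (p₀, u₀)
  let g' : P × ℝ → P × ℝ →L[ℝ] ℝ := fderiv ℝ g
  have hg'c : Continuous g' := hg.continuous_fderiv (by simp)
  let a : X := ⟨fun t => g' (p₀, u₀ t) (0, 1), by fun_prop⟩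
  -- the derivative of `Ψ` at the given solution
  have hsup := hasFDerivAt_superposition (K := unitInterval) (ContinuousLinearMap.id ℝ _) gc
    ⟨g', hg'c⟩ (fun v => (hg.differentiable (by simp) v).hasFDerivAt) (pair z₀)
  let D : P × X →L[ℝ] X := volterra ∘L
    (pointwiseBilinear unitInterval (ContinuousLinearMap.id ℝ _)
      ((⟨g', hg'c⟩ : C(P × ℝ, P × ℝ →L[ℝ] ℝ)).comp (pair z₀)) ∘L pairL)
  have hD : HasFDerivAt (fun z => volterra (gc.comp (pair z))) D z₀ :=
    volterra.hasFDerivAt.comp z₀ (hsup.comp z₀ pairL.hasFDerivAt)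
  let T : P × X →L[ℝ] P × X := (ContinuousLinearMap.fst ℝ P X).prod
    (ContinuousLinearMap.snd ℝ P X - D)
  have hT : HasFDerivAt Ψ T z₀ := hasFDerivAt_fst.prodMk (hasFDerivAt_snd.sub hD)
  have hD2 : ∀ h : X, D (0, h) = volterra (a * h) := by
    intro h
    refine congrArg volterra (ContinuousMap.ext fun t => ?_)
    change g' (p₀, u₀ t) (0, h t) = g' (p₀, u₀ t) (0, 1) * h t
    have : ((0 : P), h t) = h t • ((0 : P), (1 : ℝ)) := by simp
    rw [this, map_smul, smul_eq_mul, mul_comm]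
  have hbij := bijective_sub_volterra_mul a
  have hTbij : Function.Bijective T := by
    constructor
    · rw [injective_iff_map_eq_zero]
      rintro ⟨q, h⟩ hz
      have h1 : q = 0 := congrArg Prod.fst hz
      subst h1
      have h2 : h - D (0, h) = 0 := congrArg Prod.snd hz
      rw [hD2] at h2
      have : h = 0 := hbij.1 (by simpa using h2)
      rw [this]; rfl
    · rintro ⟨q, k⟩
      obtain ⟨h, hh⟩ := hbij.2 (k + D (q, 0))
      refine ⟨(q, h), Prod.ext rfl ?_⟩
      change h - D (q, h) = k
      have : ((q, h) : P × X) = (q, 0) + (0, h) := by simp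
      rw [this, map_add, hD2]
      have hh' : h - volterra (a * h) = k + D (q, 0) := hh
      rw [sub_eq_iff_eq_add] at hh'
      rw [sub_eq_iff_eq_add]
      nth_rewrite 1 [hh']
      abel
  let Te : (P × X) ≃L[ℝ] P × X := ContinuousLinearEquiv.ofBijective T
    (LinearMap.ker_eq_bot.2 hTbij.1) (LinearMap.range_eq_top.2 hTbij.2)
  have hTe : HasFDerivAt Ψ (Te : P × X →L[ℝ] P × X) z₀ := hT
  have hcd : ContDiffAt ℝ ∞ Ψ z₀ := hΨ.contDiffAt
  let e := hcd.toOpenPartialHomeomorph Ψ hTe (by simp)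
  have he : ∀ z, e z = Ψ z := fun z => rfl
  have hz₀s : z₀ ∈ e.source := hcd.mem_toOpenPartialHomeomorph_source hTe (by simp)
  have hsymm : ContDiffAt ℝ ∞ e.symm (Ψ z₀) := hcd.to_localInverse hTe (by simp)
  have hΨz₀ : Ψ z₀ = (p₀, 0) := by
    refine Prod.ext rfl ?_
    change u₀ - volterra (gc.comp (pair z₀)) = 0
    ext t
    rw [ContinuousMap.sub_apply, ← eq_volterra_of_hasDerivAt (y := s p₀) h0.self_of_nhds
      (fun t => hode0 t t.2) t]
    simp [u₀]
  rw [hΨz₀] at hsymm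
  have hcomp : ContDiffAt ℝ ∞ (fun p : P => (e.symm (p, 0)).2 1) p₀ :=
    (ContinuousMap.evalCLM ℝ (1 : unitInterval)).contDiff.contDiffAt.comp p₀
      (contDiffAt_snd.comp p₀ (hsymm.comp p₀ (contDiffAt_id.prodMk contDiffAt_const)))
  refine hcomp.congr_of_eventuallyEq ?_
  have hmem : ∀ᶠ p in 𝓝 p₀, ((p, 0) : P × X) ∈ e.target := by
    have hc : ContinuousAt (fun p : P => ((p, 0) : P × X)) p₀ := by fun_prop
    refine hc.eventually (e.open_target.mem_nhds ?_)
    change ((p₀, 0) : P × X) ∈ e.target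
    rw [← hΨz₀]
    exact e.map_source hz₀s
  filter_upwards [hmem, h0, hs] with p hp hp0 hps
  -- The local inverse yields a solution at `p`, which is the given one by uniqueness.
  rcases hv : e.symm (p, 0) with ⟨q, v⟩
  have hinv : Ψ (e.symm (p, 0)) = (p, 0) := e.right_inv hp
  rw [hv] at hinv
  have hq : q = p := congrArg Prod.fst hinv
  subst hq
  have hv' : v = volterra (gc.comp (pair (q, v))) := sub_eq_zero.1 (congrArg Prod.snd hinv)
  let y : ℝ → ℝ := fun t => ∫ r in (0 : ℝ)..t, IccExtend zero_le_one (gc.comp (pair (q, v))) r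
  have hyv : ∀ t : unitInterval, y t = v t := fun t => by
    conv_rhs => rw [hv']
    rfl
  have := eqOn_of_scalar_ode (g := fun x => g (q, x)) (u := s q) (v := y)
    ((hg.comp (contDiff_prodMk_right q)).of_le (by simp)) (fun t ht => (hps t ht).hasDerivWithinAt)
    (fun t ht => by
      refine ((hasDerivAt_integral_IccExtend _ t).congr_deriv ?_).hasDerivWithinAt
      rw [IccExtend_of_mem _ _ ht]
      change g (q, v ⟨t, ht⟩) = g (q, y t)
      rw [← hyv]) (by simp [y, hp0]) (right_mem_Icc.2 zero_le_one)
  exact this.trans (hyv 1)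

end ScalarODE

/-! ### Scalar differential equations with a parameter in a manifold -/

section ScalarODEManifold

/-- A scalar equation with bounded `C¹` right-hand side has a solution defined for all times: the
bound makes the Picard-Lindelöf theorem applicable on arbitrarily long time intervals. -/
theorem exists_scalar_ode {g : ℝ → ℝ} (hg : ContDiff ℝ 1 g) {C : ℝ} (hC : ∀ x, |g x| ≤ C) :
    ∃ u : ℝ → ℝ, u 0 = 0 ∧ ∀ t, HasDerivAt u (g (u t)) t := by
  have hv : ContMDiff 𝓘(ℝ, ℝ) 𝓘(ℝ, ℝ).tangent 1
      (fun x : ℝ => (⟨x, g x⟩ : TangentBundle 𝓘(ℝ, ℝ) ℝ)) :=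
    contMDiff_vectorSpace_iff_contDiff.2 hg
  have hC0 : 0 ≤ C := (abs_nonneg _).trans (hC 0)
  obtain ⟨u, hu0, hu⟩ := (exists_isMIntegralCurve_iff_exists_isMIntegralCurveOn_Ioo hv 0).2 (by
    intro a
    obtain ⟨K, hK⟩ :=
      (hg.contDiffOn (s := Metric.closedBall (0 : ℝ) (C * |a|))).exists_lipschitzOnWith one_ne_zero
      (convex_closedBall 0 _) (isCompact_closedBall 0 _)
    have hPL : IsPicardLindelof (fun _ : ℝ => g) (tmin := -|a|) (tmax := |a|)
        ⟨0, by simp⟩ 0 (C * |a|).toNNReal 0 C.toNNReal K := by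
      refine IsPicardLindelof.of_time_independent (fun x _ => ?_) ?_ ?_
      · rw [Real.coe_toNNReal _ hC0]
        exact hC x
      · rwa [Real.coe_toNNReal _ (by positivity)]
      · simp [Real.coe_toNNReal _ hC0, Real.coe_toNNReal _ (mul_nonneg hC0 (abs_nonneg a))]
    obtain ⟨u, hu0, hu⟩ := hPL.exists_eq_forall_mem_Icc_hasDerivWithinAt₀
    have hsub : Ioo (-a) a ⊆ Icc (-|a|) |a| := fun t ht =>
      ⟨(neg_le_neg (le_abs_self a)).trans ht.1.le, ht.2.le.trans (le_abs_self a)⟩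
    exact ⟨u, hu0, fun t ht =>
      ((hu t (hsub ht)).mono hsub).hasFDerivWithinAt.hasMFDerivWithinAt⟩)
  refine ⟨u, hu0, fun t => ?_⟩
  have h : HasFDerivAt u ((1 : ℝ →L[ℝ] ℝ).smulRight (g (u t))) t :=
    hasMFDerivAt_iff_hasFDerivAt.1 (hu t)
  simpa using h.hasDerivAt

variable {EQ : Type*} [NormedAddCommGroup EQ] [NormedSpace ℝ EQ] [FiniteDimensional ℝ EQ]
  {HQ : Type*} [TopologicalSpace HQ] {J : ModelWithCorners ℝ EQ HQ} [J.Boundaryless]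
  {Q : Type*} [TopologicalSpace Q] [ChartedSpace HQ Q] [IsManifold J ∞ Q]

/-- Smooth dependence on a parameter in a manifold. -/
theorem contMDiff_scalar_ode {g : Q × ℝ → ℝ} (hg : ContMDiff (J.prod 𝓘(ℝ, ℝ)) 𝓘(ℝ, ℝ) ∞ g)
    {s : Q → ℝ → ℝ} (h0 : ∀ q, s q 0 = 0)
    (hs : ∀ q, ∀ t ∈ Icc (0 : ℝ) 1, HasDerivAt (s q) (g (q, s q t)) t) :
    ContMDiff J 𝓘(ℝ, ℝ) ∞ (fun q => s q 1) := by
  intro q₀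
  set e := extChartAt J q₀ with he
  have htgt : IsOpen e.target := isOpen_extChartAt_target q₀
  obtain ⟨r, hr, hsub⟩ := Metric.nhds_basis_closedBall.mem_iff.1
    (htgt.mem_nhds (mem_extChartAt_target q₀))
  let χ : ContDiffBump (e q₀) := ⟨r / 2, r, by positivity, by linarith⟩
  have hes : ∀ y ∈ e.target, ContMDiffAt 𝓘(ℝ, EQ) J ∞ e.symm y := fun y hy =>
    (contMDiffOn_extChartAt_symm q₀).contMDiffAt (htgt.mem_nhds hy)
  -- the right-hand side in the chart at `q₀`, cut off to be globally defined
  let G : EQ × ℝ → ℝ := fun p => χ p.1 * g (e.symm p.1, p.2)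
  have hG : ContDiff ℝ ∞ G := by
    rw [contDiff_iff_contDiffAt]
    rintro ⟨y, u⟩
    by_cases hy : y ∈ e.target
    · have h1 : ContMDiffAt 𝓘(ℝ, EQ × ℝ) 𝓘(ℝ, ℝ) ∞ (fun p : EQ × ℝ => g (e.symm p.1, p.2))
          (y, u) := by
        refine hg.contMDiffAt.comp (y, u) (ContMDiffAt.prodMk ?_ ?_)
        · exact (hes y hy).comp (y, u) contDiffAt_fst.contMDiffAt
        · exact contDiffAt_snd.contMDiffAt
      exact (χ.contDiff.contDiffAt.comp (y, u) contDiffAt_fst).mul h1.contDiffAt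
    · have hy' : y ∈ (Metric.closedBall (e q₀) r)ᶜ := fun h => hy (hsub h)
      have hopen : IsOpen (Metric.closedBall (e q₀) r)ᶜ := Metric.isClosed_closedBall.isOpen_compl
      refine (contDiffAt_const (c := (0 : ℝ))).congr_of_eventuallyEq ?_
      filter_upwards [continuousAt_fst.eventually (hopen.mem_nhds hy')] with p hp
      have : χ p.1 = 0 := χ.zero_of_le_dist (by
        have : ¬ dist p.1 (e q₀) ≤ r := hp
        exact (not_le.1 this).le)
      simp [G, this]
  have hloc : ContDiffAt ℝ ∞ (fun y => s (e.symm y) 1) (e q₀) := by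
    refine contDiffAt_scalar_ode (s := fun y => s (e.symm y)) hG
      (Filter.Eventually.of_forall fun y => h0 _) ?_
    filter_upwards [χ.eventuallyEq_one] with y hy t ht
    refine (hs (e.symm y) t ht).congr_deriv ?_
    have hy' : χ y = 1 := hy
    simp [G, hy']
  have hcomp : ContMDiffAt J 𝓘(ℝ, ℝ) ∞ (fun q => s (e.symm (e q)) 1) q₀ :=
    hloc.contMDiffAt.comp q₀ contMDiffAt_extChartAt
  refine hcomp.congr_of_eventuallyEq ?_
  filter_upwards [extChartAt_source_mem_nhds (I := J) q₀] with q hq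
  rw [e.left_inv hq]

end ScalarODEManifold

/-! ### Fiberwise affine maps to the cotangent bundle -/

section FiberwiseAffine

variable {F : Type*} [NormedAddCommGroup F] [NormedSpace ℝ F]
  {L : Type*} [TopologicalSpace L] [ChartedSpace F L] [IsManifold 𝓘(ℝ, F) ∞ L]
  {EQ : Type*} [NormedAddCommGroup EQ] [NormedSpace ℝ EQ]
  {HQ : Type*} [TopologicalSpace HQ] {J : ModelWithCorners ℝ EQ HQ}
  {Q : Type*} [TopologicalSpace Q] [ChartedSpace HQ Q]

theorem contMDiff_cotangent_proj : ContMDiff (cotangentModel F) 𝓘(ℝ, F) ∞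
    (fun ξ : Cotangent F L => ξ.1) :=
  contMDiff_proj _

/-- Fiberwise affine combinations of smooth maps to `T^*L` over the same base map are smooth. -/
theorem contMDiff_add_smul {b : Q → L} {A B : ∀ q, TangentSpace 𝓘(ℝ, F) (b q) →L[ℝ] ℝ} {c : Q → ℝ}
    (hA : ContMDiff J (cotangentModel F) ∞ (fun q => (⟨b q, A q⟩ : Cotangent F L)))
    (hB : ContMDiff J (cotangentModel F) ∞ (fun q => (⟨b q, B q⟩ : Cotangent F L)))
    (hc : ContMDiff J 𝓘(ℝ, ℝ) ∞ c) :
    ContMDiff J (cotangentModel F) ∞ (fun q => (⟨b q, A q + c q • B q⟩ : Cotangent F L)) := by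
  intro q₀
  have hA' := contMDiffAt_totalSpace.1 (hA q₀)
  have hB' := contMDiffAt_totalSpace.1 (hB q₀)
  refine contMDiffAt_totalSpace.2 ⟨hA'.1, ?_⟩
  refine (hA'.2.add ((hc q₀).smul hB'.2)).congr_of_eventuallyEq ?_
  set e := trivializationAt (F →L[ℝ] ℝ) (fun x : L => TangentSpace 𝓘(ℝ, F) x →L[ℝ] ℝ) (b q₀)
  have hmem : ∀ᶠ q in 𝓝 q₀, b q ∈ e.baseSet :=
    hA'.1.continuousAt.eventually (e.open_baseSet.mem_nhds
      (FiberBundle.mem_baseSet_trivializationAt' (b q₀)))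
  filter_upwards [hmem] with q hq
  have hl := e.linear ℝ hq
  exact (hl.map_add _ _).trans (congrArg _ (hl.map_smul _ _))

end FiberwiseAffine

/-! ### The inverse function theorem on manifolds -/

section InverseFunction

variable {EQ : Type*} [NormedAddCommGroup EQ] [NormedSpace ℝ EQ] [FiniteDimensional ℝ EQ]
  {HQ : Type*} [TopologicalSpace HQ] {J : ModelWithCorners ℝ EQ HQ} [J.Boundaryless]
  {Q : Type*} [TopologicalSpace Q] [ChartedSpace HQ Q] [IsManifold J ∞ Q]
  {Q' : Type*} [TopologicalSpace Q'] [ChartedSpace HQ Q']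

/-- The inverse of a smooth bijection with injective differentials is smooth. -/
theorem contMDiff_inverse {f : Q → Q'} {g : Q' → Q} (hf : ContMDiff J J ∞ f)
    (hinj : ∀ x, Function.Injective (mfderiv J J f x))
    (hgf : Function.LeftInverse g f) (hfg : Function.RightInverse g f) : ContMDiff J J ∞ g := by
  intro z
  obtain ⟨x, rfl⟩ : ∃ x, f x = z := ⟨g z, hfg z⟩
  set e := extChartAt J x
  set e' := extChartAt J (f x)
  set φ : EQ → EQ := writtenInExtChartAt J J x f
  have hφ : ContDiffAt ℝ ∞ φ (e x) := by
    have := (contMDiffAt_iff.1 (hf x)).2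
    rwa [J.range_eq_univ, contDiffWithinAt_univ] at this
  let A : EQ →L[ℝ] EQ := mfderiv J J f x
  have hd : HasFDerivAt φ A (e x) := by
    have h : HasFDerivWithinAt φ A (range J) (e x) :=
      (((hf x).mdifferentiableAt (by simp)).hasMFDerivAt).2
    rwa [J.range_eq_univ, hasFDerivWithinAt_univ] at h
  have hi : Function.Injective (A : EQ →ₗ[ℝ] EQ) := hinj x
  let T : EQ ≃L[ℝ] EQ := (LinearEquiv.ofInjectiveEndo (A : EQ →ₗ[ℝ] EQ) hi).toContinuousLinearEquiv
  have hT : HasFDerivAt φ (T : EQ →L[ℝ] EQ) (e x) := hd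
  let o := hφ.toOpenPartialHomeomorph φ hT (by simp)
  have hos : e x ∈ o.source := hφ.mem_toOpenPartialHomeomorph_source hT (by simp)
  have hφx : φ (e x) = e' (f x) := by simp [φ, e, e', writtenInExtChartAt]
  have hsymm : ContDiffAt ℝ ∞ o.symm (e' (f x)) := by
    rw [← hφx]
    exact hφ.to_localInverse hT (by simp)
  have hox : o.symm (e' (f x)) = e x := by
    rw [← hφx]
    exact o.left_inv hos
  -- a local right inverse of `f`
  let k : Q' → Q := fun z => e.symm (o.symm (e' z))
  have hkx : k (f x) = x := by simp [k, hox, e]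
  have hk : ContMDiffAt J J ∞ k (f x) := by
    have h1 : ContMDiffAt J 𝓘(ℝ, EQ) ∞ (fun z => o.symm (e' z)) (f x) :=
      hsymm.contMDiffAt.comp (f x) contMDiffAt_extChartAt
    have h2 : ContMDiffAt 𝓘(ℝ, EQ) J ∞ e.symm (o.symm (e' (f x))) := by
      rw [hox]
      exact (contMDiffOn_extChartAt_symm x).contMDiffAt
        ((isOpen_extChartAt_target x).mem_nhds (mem_extChartAt_target x))
    exact h2.comp (f x) h1
  refine hk.congr_of_eventuallyEq ?_
  have hfk : ContinuousAt (fun z => f (k z)) (f x) := by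
    have : ContinuousAt f (k (f x)) := (hf _).continuousAt
    exact this.comp hk.continuousAt
  have h1 : ∀ᶠ z in 𝓝 (f x), f (k z) ∈ e'.source := by
    refine hfk.eventually ((isOpen_extChartAt_source (f x)).mem_nhds ?_)
    change f (k (f x)) ∈ e'.source
    rw [hkx]
    exact mem_extChartAt_source (f x)
  have h2 : ∀ᶠ z in 𝓝 (f x), z ∈ e'.source := extChartAt_source_mem_nhds (f x)
  have h3 : ∀ᶠ z in 𝓝 (f x), e' z ∈ o.target := by
    refine (continuousAt_extChartAt (f x)).eventually (o.open_target.mem_nhds ?_)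
    change e' (f x) ∈ o.target
    rw [← hφx]
    exact o.map_source hos
  filter_upwards [h1, h2, h3] with z hz1 hz2 hz3
  have h4 : e' (f (k z)) = e' z := o.right_inv hz3
  have h5 : f (k z) = z := e'.injOn hz1 hz2 h4
  conv_lhs => rw [← h5]
  exact hgf _

end InverseFunction

/-! ### Lagrangian submanifolds under diffeomorphisms -/

section Immersion

variable {E : Type*} [NormedAddCommGroup E] [NormedSpace ℝ E]
  {M : Type*} [TopologicalSpace M] [ChartedSpace E M] [IsManifold 𝓘(ℝ, E) ∞ M]
  {F : Type*} [NormedAddCommGroup F] [NormedSpace ℝ F]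
  {L : Type*} [TopologicalSpace L] [ChartedSpace F L]

/-- The composition of a diffeomorphism and a smooth embedding is a smooth embedding. -/
theorem isSmoothEmbedding_diffeomorph_comp (φ : M ≃ₘ^∞⟮𝓘(ℝ, E), 𝓘(ℝ, E)⟯ M) {j : L → M}
    (hj : IsSmoothEmbedding 𝓘(ℝ, F) 𝓘(ℝ, E) ∞ j) :
    IsSmoothEmbedding 𝓘(ℝ, F) 𝓘(ℝ, E) ∞ (φ ∘ j) := by
  refine ⟨?_, φ.toHomeomorph.isEmbedding.comp hj.isEmbedding⟩
  obtain ⟨C, i1, i2, hC⟩ := hj.isImmersion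
  refine ⟨C, i1, i2, fun x => ?_⟩
  have h := hC x
  -- The chart of `M` is transported by `φ`.
  let c : OpenPartialHomeomorph M E :=
    φ.symm.toHomeomorph.toOpenPartialHomeomorph.trans h.codChart
  have hc : c ∈ IsManifold.maximalAtlas 𝓘(ℝ, E) ∞ M := by
    refine OpenPartialHomeomorph.mem_maximalAtlas_of_contMDiffOn c ?_ ?_
    · exact (contMDiffOn_of_mem_maximalAtlas h.codChart_mem_maximalAtlas).comp
        φ.symm.contMDiff.contMDiffOn (fun y hy => by simpa [c] using hy)
    · exact φ.contMDiff.comp_contMDiffOn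
        ((contMDiffOn_symm_of_mem_maximalAtlas h.codChart_mem_maximalAtlas).mono
          (fun y hy => by simpa [c] using hy))
  have hcs : ∀ y, φ y ∈ c.source ↔ y ∈ h.codChart.source := fun y => by simp [c]
  refine Manifold.IsImmersionAtOfComplement.mk_of_charts h.equiv h.domChart c
    h.mem_domChart_source ((hcs _).2 h.mem_codChart_source) h.domChart_mem_maximalAtlas hc
    (fun y hy => (hcs _).2 (h.source_subset_preimage_source hy)) ?_
  intro y hy
  rw [← h.writtenInCharts hy]
  simp [c]

/-- A diffeomorphism that pulls `Ω` back to `Ω'` transports Lagrangian embeddings. -/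
theorem IsLagrangianEmbedding.of_comp {Ω Ω' : SymplecticForm E M}
    (φ : M ≃ₘ^∞⟮𝓘(ℝ, E), 𝓘(ℝ, E)⟯ M) (hφ : Ω'.form = DiffForm.pullback φ Ω.form) {j : L → M}
    (hj : IsLagrangianEmbedding (F := F) Ω (φ ∘ j)) : IsLagrangianEmbedding (F := F) Ω' j := by
  have he : IsSmoothEmbedding 𝓘(ℝ, F) 𝓘(ℝ, E) ∞ j := by
    have := isSmoothEmbedding_diffeomorph_comp φ.symm hj.embedding
    have hs : (φ.symm : M → M) ∘ φ ∘ j = j := by ext x; simp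
    rwa [hs] at this
  refine ⟨he, fun x v => ?_⟩
  have hjd : MDifferentiableAt 𝓘(ℝ, F) 𝓘(ℝ, E) j x := he.contMDiff.mdifferentiableAt (by simp)
  have hφd : MDifferentiableAt 𝓘(ℝ, E) 𝓘(ℝ, E) φ (j x) := φ.contMDiff.mdifferentiableAt (by simp)
  have hcomp := mfderiv_comp x hφd hjd
  have hφi : Function.Injective (mfderiv 𝓘(ℝ, E) 𝓘(ℝ, E) φ (j x)) := by
    rw [← φ.mfderivToContinuousLinearEquiv_coe (by simp)]
    exact (φ.mfderivToContinuousLinearEquiv (by simp) (j x)).injective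
  have key : ∀ a b : TangentSpace 𝓘(ℝ, E) (j x), Ω'.form (j x) ![a, b] =
      Ω.form (φ (j x)) ![mfderiv 𝓘(ℝ, E) 𝓘(ℝ, E) φ (j x) a, mfderiv 𝓘(ℝ, E) 𝓘(ℝ, E) φ (j x) b] := by
    intro a b
    rw [hφ]
    refine congrArg (Ω.form (φ (j x))) (funext fun i => ?_)
    fin_cases i <;> rfl
  have hl := hj.lagrangian x (mfderiv 𝓘(ℝ, E) 𝓘(ℝ, E) φ (j x) v)
  rw [hcomp] at hl
  have h1 : (v ∈ range (mfderiv 𝓘(ℝ, F) 𝓘(ℝ, E) j x)) ↔ (mfderiv 𝓘(ℝ, E) 𝓘(ℝ, E) φ (j x) v ∈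
      range ((mfderiv 𝓘(ℝ, E) 𝓘(ℝ, E) φ (j x)).comp (mfderiv 𝓘(ℝ, F) 𝓘(ℝ, E) j x))) :=
    ⟨fun ⟨w, hw⟩ => ⟨w, congrArg _ hw⟩, fun ⟨w, hw⟩ => ⟨w, hφi hw⟩⟩
  rw [h1]
  refine Iff.trans hl (forall_congr' fun w => ?_)
  rw [key]
  rfl

/-- Lagrangian submanifolds are transported by diffeomorphisms that match the symplectic forms. -/
theorem IsLagrangianSubmanifold.of_image {Ω Ω' : SymplecticForm E M}
    (φ : M ≃ₘ^∞⟮𝓘(ℝ, E), 𝓘(ℝ, E)⟯ M) (hφ : Ω'.form = DiffForm.pullback φ Ω.form) {S : Set M}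
    (h : IsLagrangianSubmanifold F L Ω (φ '' S)) : IsLagrangianSubmanifold F L Ω' S := by
  obtain ⟨j, hj, hjS⟩ := h
  have hs : (φ : M → M) ∘ (φ.symm ∘ j) = j := by ext x; simp
  refine ⟨φ.symm ∘ j, IsLagrangianEmbedding.of_comp φ hφ (by rwa [hs]), ?_⟩
  rw [range_comp, hjS, ← image_comp]
  simp

end Immersion

/-! ### Pullbacks of differential forms -/

section Pullback

/-- The pullback of an alternating form by a linear map depends smoothly on both. -/
theorem contDiff_compContinuousLinearMap {E : Type*} [NormedAddCommGroup E] [NormedSpace ℝ E]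
    [FiniteDimensional ℝ E] (k : ℕ) :
    ContDiff ℝ ∞ (fun p : (E [⋀^Fin k]→L[ℝ] ℝ) × (E →L[ℝ] E) =>
      p.1.compContinuousLinearMap p.2) := by
  let Λ : (E [⋀^Fin k]→L[ℝ] ℝ) →L[ℝ] ContinuousMultilinearMap ℝ (fun _ : Fin k => E) ℝ :=
    ContinuousAlternatingMap.toContinuousMultilinearMapCLM ℝ
  have hΛ : Function.Injective Λ := ContinuousAlternatingMap.toContinuousMultilinearMap_injective
  have hfin : FiniteDimensional ℝ (ContinuousMultilinearMap ℝ (fun _ : Fin k => E) ℝ) :=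
    FiniteDimensional.of_injective
      (ContinuousMultilinearMap.toMultilinearMapLinear :
        ContinuousMultilinearMap ℝ (fun _ : Fin k => E) ℝ →ₗ[ℝ] _)
      ContinuousMultilinearMap.toMultilinearMap_injective
  -- In finite dimension the inclusion into multilinear maps has a continuous left inverse.
  let Λ' : (E [⋀^Fin k]→L[ℝ] ℝ) →ₗ[ℝ] ContinuousMultilinearMap ℝ (fun _ : Fin k => E) ℝ := Λ
  obtain ⟨R, hR⟩ := Λ'.exists_leftInverse_of_injective (LinearMap.ker_eq_bot.2 hΛ)
  let Rc := LinearMap.toContinuousLinearMap R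
  let c := ContinuousMultilinearMap.compContinuousLinearMapContinuousMultilinear ℝ
    (fun _ : Fin k => E) (fun _ : Fin k => E) ℝ
  have h : ContDiff ℝ ∞ (fun p : (E [⋀^Fin k]→L[ℝ] ℝ) × (E →L[ℝ] E) =>
      c (fun _ => p.2) (Λ p.1)) :=
    (c.contDiff.comp (contDiff_pi.2 fun _ => contDiff_snd)).clm_apply (Λ.contDiff.comp contDiff_fst)
  convert Rc.contDiff.comp h using 1
  funext p
  exact (LinearMap.congr_fun hR (p.1.compContinuousLinearMap p.2)).symm

variable {E : Type*} [NormedAddCommGroup E] [NormedSpace ℝ E]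
  {M : Type*} [TopologicalSpace M] [ChartedSpace E M]
  {E' : Type*} [NormedAddCommGroup E'] [NormedSpace ℝ E']
  {N : Type*} [TopologicalSpace N] [ChartedSpace E' N]
  {E'' : Type*} [NormedAddCommGroup E''] [NormedSpace ℝ E'']
  {P : Type*} [TopologicalSpace P] [ChartedSpace E'' P] {k : ℕ}

theorem DiffForm.pullback_congr {g₁ g₂ : M → N} (α : DiffForm 𝓘(ℝ, E') N k) {x : M}
    (h : g₁ =ᶠ[𝓝 x] g₂) :
    (α.pullback g₁ : DiffForm 𝓘(ℝ, E) M k) x = (α.pullback g₂ : DiffForm 𝓘(ℝ, E) M k) x := by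
  have h1 : (α (g₁ x) : E' [⋀^Fin k]→L[ℝ] ℝ) = α (g₂ x) :=
    let β : N → E' [⋀^Fin k]→L[ℝ] ℝ := α
    congrArg β h.eq_of_nhds
  have h2 : (mfderiv 𝓘(ℝ, E) 𝓘(ℝ, E') g₁ x : E →L[ℝ] E') = mfderiv 𝓘(ℝ, E) 𝓘(ℝ, E') g₂ x :=
    h.mfderiv_eq
  exact congrArg₂ (fun (a : E' [⋀^Fin k]→L[ℝ] ℝ) (b : E →L[ℝ] E') =>
    a.compContinuousLinearMap b) h1 h2

theorem DiffForm.pullback_comp_apply {f : M → N} {g : N → P} (α : DiffForm 𝓘(ℝ, E'') P k) {x : M}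
    (hf : MDifferentiableAt 𝓘(ℝ, E) 𝓘(ℝ, E') f x)
    (hg : MDifferentiableAt 𝓘(ℝ, E') 𝓘(ℝ, E'') g (f x)) :
    (α.pullback (g ∘ f) : DiffForm 𝓘(ℝ, E) M k) x =
      (DiffForm.pullback f (α.pullback g : DiffForm 𝓘(ℝ, E') N k) : DiffForm 𝓘(ℝ, E) M k) x := by
  ext v
  simp only [DiffForm.pullback, mfderiv_comp x hg hf]
  rfl

theorem DiffForm.pullback_comp {f : M → N} {g : N → P} (α : DiffForm 𝓘(ℝ, E'') P k)
    (hf : MDifferentiable 𝓘(ℝ, E) 𝓘(ℝ, E') f) (hg : MDifferentiable 𝓘(ℝ, E') 𝓘(ℝ, E'') g) :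
    (α.pullback (g ∘ f) : DiffForm 𝓘(ℝ, E) M k) =
      DiffForm.pullback f (α.pullback g : DiffForm 𝓘(ℝ, E') N k) :=
  funext fun x => DiffForm.pullback_comp_apply α (hf x) (hg (f x))

theorem DiffForm.pullback_id (α : DiffForm 𝓘(ℝ, E) M k) :
    (α.pullback (fun x => x) : DiffForm 𝓘(ℝ, E) M k) = α := by
  funext x
  ext v
  have : mfderiv 𝓘(ℝ, E) 𝓘(ℝ, E) (fun x : M => x) x = ContinuousLinearMap.id ℝ _ := mfderiv_id
  simp only [DiffForm.pullback, this]
  rfl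

variable [IsManifold 𝓘(ℝ, E) ∞ M] [IsManifold 𝓘(ℝ, E') ∞ N]

/-- The expression of a smooth map in two given charts. -/
theorem contDiffAt_chart_expression {φ : M → N} (hφ : ContMDiff 𝓘(ℝ, E) 𝓘(ℝ, E') ∞ φ) {x₀ : M}
    {y₁ : N} {y : E} (hy : y ∈ (extChartAt 𝓘(ℝ, E) x₀).target)
    (hy₁ : φ ((extChartAt 𝓘(ℝ, E) x₀).symm y) ∈ (extChartAt 𝓘(ℝ, E') y₁).source) :
    ContDiffAt ℝ ∞ (fun z => extChartAt 𝓘(ℝ, E') y₁ (φ ((extChartAt 𝓘(ℝ, E) x₀).symm z))) y := by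
  refine ContMDiffAt.contDiffAt ?_
  refine ContMDiffAt.comp y (g := extChartAt 𝓘(ℝ, E') y₁) (I' := 𝓘(ℝ, E'))
    (contMDiffAt_extChartAt' (by simpa using hy₁)) (hφ.contMDiffAt.comp y ?_)
  exact (contMDiffOn_extChartAt_symm x₀).contMDiffAt
    ((isOpen_extChartAt_target x₀).mem_nhds hy)

/-- In charts, the pullback by `φ` is the pullback by the chart expression of `φ`. -/
theorem DiffForm.inChart_pullback {φ : M → N} (hφ : ContMDiff 𝓘(ℝ, E) 𝓘(ℝ, E') ∞ φ)
    (α : DiffForm 𝓘(ℝ, E') N k) {x₀ : M} {y₁ : N} {y : E}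
    (hy : y ∈ (extChartAt 𝓘(ℝ, E) x₀).target)
    (hy₁ : φ ((extChartAt 𝓘(ℝ, E) x₀).symm y) ∈ (extChartAt 𝓘(ℝ, E') y₁).source) :
    (α.pullback φ : DiffForm 𝓘(ℝ, E) M k).inChart x₀ y =
      (α.inChart y₁ (extChartAt 𝓘(ℝ, E') y₁
        (φ ((extChartAt 𝓘(ℝ, E) x₀).symm y)))).compContinuousLinearMap
      (fderiv ℝ (fun z => extChartAt 𝓘(ℝ, E') y₁ (φ ((extChartAt 𝓘(ℝ, E) x₀).symm z))) y) := by
  set e₀ := extChartAt 𝓘(ℝ, E) x₀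
  set e₁ := extChartAt 𝓘(ℝ, E') y₁
  set f : E → E' := fun z => e₁ (φ (e₀.symm z)) with hf
  have he₀ : ContMDiffAt 𝓘(ℝ, E) 𝓘(ℝ, E) ∞ e₀.symm y :=
    (contMDiffOn_extChartAt_symm x₀).contMDiffAt ((isOpen_extChartAt_target x₀).mem_nhds hy)
  have he₁ : ContMDiffAt 𝓘(ℝ, E') 𝓘(ℝ, E') ∞ e₁.symm (f y) :=
    (contMDiffOn_extChartAt_symm y₁).contMDiffAt
      ((isOpen_extChartAt_target y₁).mem_nhds (e₁.map_source hy₁))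
  have hfd : MDifferentiableAt 𝓘(ℝ, E) 𝓘(ℝ, E') f y :=
    ((contDiffAt_chart_expression hφ hy hy₁).contMDiffAt).mdifferentiableAt (by simp)
  have hev : φ ∘ e₀.symm =ᶠ[𝓝 y] e₁.symm ∘ f := by
    have hc : ContinuousAt (φ ∘ e₀.symm) y := hφ.continuous.continuousAt.comp he₀.continuousAt
    filter_upwards [hc.eventually ((isOpen_extChartAt_source y₁).mem_nhds hy₁)] with z hz
    exact (e₁.left_inv hz).symm
  have h1 := DiffForm.pullback_comp_apply α (he₀.mdifferentiableAt (by simp))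
    (hφ.mdifferentiableAt (x := e₀.symm y) (by simp))
  have h2 := DiffForm.pullback_comp_apply α hfd (he₁.mdifferentiableAt (by simp))
  have h3 : (α.pullback (φ ∘ e₀.symm) : DiffForm 𝓘(ℝ, E) E k) y = _ := α.pullback_congr hev
  rw [← mfderiv_eq_fderiv]
  exact h1.symm.trans (h3.trans h2)

theorem DiffForm.IsSmooth.pullback [FiniteDimensional ℝ E] {φ : M → M}
    (hφ : ContMDiff 𝓘(ℝ, E) 𝓘(ℝ, E) ∞ φ) {α : DiffForm 𝓘(ℝ, E) M k} (hα : α.IsSmooth) :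
    (α.pullback φ : DiffForm 𝓘(ℝ, E) M k).IsSmooth := by
  intro x₀ y hy
  refine ContDiffAt.contDiffWithinAt ?_
  set y₁ := φ ((extChartAt 𝓘(ℝ, E) x₀).symm y) with hy₁
  have hy₁s : y₁ ∈ (extChartAt 𝓘(ℝ, E) y₁).source := mem_extChartAt_source y₁
  have hf := contDiffAt_chart_expression hφ hy hy₁s
  have hαf : ContDiffAt ℝ ∞ (α.inChart y₁) (extChartAt 𝓘(ℝ, E) y₁ y₁) :=
    (hα y₁).contDiffAt ((isOpen_extChartAt_target y₁).mem_nhds (mem_extChartAt_target y₁))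
  refine ((contDiff_compContinuousLinearMap k).contDiffAt.comp y
    ((hαf.comp y hf).prodMk (hf.fderiv_right (m := ∞) (by simp)))).congr_of_eventuallyEq ?_
  have hc : ContinuousAt (fun z => φ ((extChartAt 𝓘(ℝ, E) x₀).symm z)) y :=
    hφ.continuous.continuousAt.comp
      ((continuousOn_extChartAt_symm x₀).continuousAt ((isOpen_extChartAt_target x₀).mem_nhds hy))
  filter_upwards [(isOpen_extChartAt_target x₀).mem_nhds hy,
    hc.eventually ((isOpen_extChartAt_source y₁).mem_nhds hy₁s)] with z hz hz₁
  exact DiffForm.inChart_pullback hφ α hz hz₁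

/-- Pullbacks of closed forms are closed. At `x` this compares the chart at `x`, in which
`d (φ^* α)` is computed, with the chart at `φ(x)`, in which `d α` is computed. -/
theorem DiffForm.d_pullback_eq_zero {φ : M → M}
    (hφ : ContMDiff 𝓘(ℝ, E) 𝓘(ℝ, E) ∞ φ) {α : DiffForm 𝓘(ℝ, E) M k} (hα : α.IsSmooth)
    (hd : α.d = 0) : (α.pullback φ : DiffForm 𝓘(ℝ, E) M k).d = 0 := by
  funext x
  set y₁ := φ x with hy₁
  set e₀ := extChartAt 𝓘(ℝ, E) x
  set e₁ := extChartAt 𝓘(ℝ, E) y₁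
  have hx : e₀ x ∈ e₀.target := mem_extChartAt_target x
  have hx' : φ (e₀.symm (e₀ x)) = y₁ := by rw [e₀.left_inv (mem_extChartAt_source x)]
  have hy₁s : φ (e₀.symm (e₀ x)) ∈ e₁.source := by
    rw [hx']
    exact mem_extChartAt_source y₁
  have hf := contDiffAt_chart_expression hφ hx hy₁s
  have hfx : e₁ (φ (e₀.symm (e₀ x))) = e₁ y₁ := congrArg e₁ hx'
  have hαf : ContDiffAt ℝ ∞ (α.inChart y₁) (e₁ y₁) :=
    (hα y₁).contDiffAt ((isOpen_extChartAt_target y₁).mem_nhds (mem_extChartAt_target y₁))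
  -- the derivative of `α` vanishes in the chart at `φ x`
  have hz : extDeriv (α.inChart y₁) (e₁ y₁) = 0 := by
    have h : (extDeriv (α.inChart y₁) (e₁ y₁)).compContinuousLinearMap
        (mfderiv 𝓘(ℝ, E) 𝓘(ℝ, E) e₁ y₁) = 0 := congrFun hd y₁
    obtain ⟨T, hT⟩ := isInvertible_mfderiv_extChartAt (I := 𝓘(ℝ, E)) (mem_extChartAt_source y₁)
    ext v
    rw [← hT] at h
    have h' : extDeriv (α.inChart y₁) (e₁ y₁) (fun i => T (T.symm (v i))) = 0 :=
      congrArg (fun a => a (fun i => T.symm (v i))) h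
    have hv : (fun i => T (T.symm (v i))) = v := funext fun i => T.apply_symm_apply (v i)
    rwa [hv] at h'
  have hev : (α.pullback φ : DiffForm 𝓘(ℝ, E) M k).inChart x =ᶠ[𝓝 (e₀ x)] fun z =>
      (α.inChart y₁ (e₁ (φ (e₀.symm z)))).compContinuousLinearMap
        (fderiv ℝ (fun z => e₁ (φ (e₀.symm z))) z) := by
    have hc : ContinuousAt (fun z => φ (e₀.symm z)) (e₀ x) :=
      hφ.continuous.continuousAt.comp
        ((continuousOn_extChartAt_symm x).continuousAt ((isOpen_extChartAt_target x).mem_nhds hx))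
    filter_upwards [(isOpen_extChartAt_target x).mem_nhds hx,
      hc.eventually ((isOpen_extChartAt_source y₁).mem_nhds hy₁s)] with z hz hz₁
    exact DiffForm.inChart_pullback hφ α hz hz₁
  have hext : extDeriv ((α.pullback φ : DiffForm 𝓘(ℝ, E) M k).inChart x) (e₀ x) = 0 := by
    rw [hev.extDeriv_eq, extDeriv_pullback (f := fun z => e₁ (φ (e₀.symm z))) (r := ∞)
      (by rw [hfx]; exact hαf.differentiableAt (by simp)) hf
      (by simpa using (ENat.LEInfty.out : (2 : ℕ∞ω) ≤ ∞)), hfx, hz]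
    rfl
  change (extDeriv ((α.pullback φ : DiffForm 𝓘(ℝ, E) M k).inChart x)
    (e₀ x)).compContinuousLinearMap _ = 0
  rw [hext]
  rfl

/-- The pullback of a symplectic form by a diffeomorphism. -/
def SymplecticForm.pullback [FiniteDimensional ℝ E] (Ω : SymplecticForm E M)
    (φ : M ≃ₘ^∞⟮𝓘(ℝ, E), 𝓘(ℝ, E)⟯ M) : SymplecticForm E M where
  form := DiffForm.pullback φ Ω.form
  smooth := Ω.smooth.pullback φ.contMDiff
  closed := DiffForm.d_pullback_eq_zero φ.contMDiff Ω.smooth Ω.closed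
  nondegenerate := fun x v hv => by
    let T := φ.mfderivToContinuousLinearEquiv (by simp) x
    have hT : (T : TangentSpace 𝓘(ℝ, E) x →L[ℝ] TangentSpace 𝓘(ℝ, E) (φ x)) =
      mfderiv 𝓘(ℝ, E) 𝓘(ℝ, E) φ x := φ.mfderivToContinuousLinearEquiv_coe (by simp)
    have h0 : T v = 0 := Ω.nondegenerate (φ x) (T v) fun w => by
      have h := hv (T.symm w)
      rw [← h]
      change _ = Ω.form (φ x) (fun i => mfderiv 𝓘(ℝ, E) 𝓘(ℝ, E) φ x (![v, T.symm w] i))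
      refine congrArg (Ω.form (φ x)) (funext fun i => ?_)
      rw [← hT]
      fin_cases i
      · rfl
      · exact (T.apply_symm_apply w).symm
    exact T.map_eq_zero_iff.1 h0

end Pullback

/-! ### Flow lines in the fibers of the cotangent bundle -/

section VerticalFlow

/-- `T^*L` is Hausdorff, so that compact subsets are closed and the function `f ∘ ψ` extends
smoothly by zero. -/
theorem t2Space_cotangent {F : Type*} [NormedAddCommGroup F] [NormedSpace ℝ F]
    {L : Type*} [TopologicalSpace L] [ChartedSpace F L] [IsManifold 𝓘(ℝ, F) ∞ L] [T2Space L] :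
    T2Space (Cotangent F L) := by
  refine ⟨fun p q hpq => ?_⟩
  by_cases h : p.1 = q.1
  · let e := trivializationAt (F →L[ℝ] ℝ) (fun x : L => TangentSpace 𝓘(ℝ, F) x →L[ℝ] ℝ) p.1
    have hp : p ∈ e.source := FiberBundle.mem_trivializationAt_proj_source
    have hq : q ∈ e.source := by
      rw [e.mem_source]
      rw [← h]
      exact FiberBundle.mem_baseSet_trivializationAt' p.1
    obtain ⟨U, V, hU, hV, hpU, hqV, hUV⟩ := t2_separation fun h' => hpq (e.injOn hp hq h')
    refine ⟨e.source ∩ e ⁻¹' U, e.source ∩ e ⁻¹' V,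
      e.toOpenPartialHomeomorph.isOpen_inter_preimage hU,
      e.toOpenPartialHomeomorph.isOpen_inter_preimage hV, ⟨hp, hpU⟩, ⟨hq, hqV⟩, ?_⟩
    exact (hUV.preimage e).mono inter_subset_right inter_subset_right
  · exact separated_by_continuous (FiberBundle.continuous_proj (F →L[ℝ] ℝ)
      (fun x : L => TangentSpace 𝓘(ℝ, F) x →L[ℝ] ℝ)) h

variable {E : Type*} [NormedAddCommGroup E] [NormedSpace ℝ E]
  {M : Type*} [TopologicalSpace M] [ChartedSpace E M]
  {F : Type*} [NormedAddCommGroup F] [NormedSpace ℝ F]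
  {L : Type*} [TopologicalSpace L] [ChartedSpace F L] [IsManifold 𝓘(ℝ, F) ∞ L]
  {Ω : SymplecticForm E M} {ι : L → M}

namespace LagrangianNeighborhood

variable (𝒩 : LagrangianNeighborhood (F := F) Ω ι)

open Classical in
/-- The cut-off function `f ∘ ψ` on `T^*L`, extended by zero outside `V`. -/
def cutoff (ζ : Cotangent F L) : ℝ := if ζ ∈ 𝒩.ψ.source then 𝒩.f (𝒩.ψ ζ) else 0

theorem cutoff_of_mem {ζ : Cotangent F L} (h : ζ ∈ 𝒩.ψ.source) : 𝒩.cutoff ζ = 𝒩.f (𝒩.ψ ζ) :=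
  if_pos h

theorem mem_source_of_cutoff_ne_zero {ζ : Cotangent F L} (h : 𝒩.cutoff ζ ≠ 0) :
    ζ ∈ 𝒩.ψ.source := by
  by_contra h'
  exact h (if_neg h')

theorem cutoff_of_mem_V' {ζ : Cotangent F L} (h : ζ ∈ 𝒩.V') : 𝒩.cutoff ζ = 1 := by
  rw [cutoff_of_mem _ (𝒩.closure_V' (subset_closure h))]
  exact 𝒩.f_one _ (subset_closure ⟨ζ, h, rfl⟩)

theorem exists_abs_cutoff_le [CompactSpace M] : ∃ C, ∀ ζ, |𝒩.cutoff ζ| ≤ C := by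
  obtain ⟨C, hC⟩ := (isCompact_range 𝒩.f_smooth.continuous).isBounded.exists_norm_le
  refine ⟨max C 0, fun ζ => ?_⟩
  rw [cutoff]
  split_ifs
  · exact (hC _ ⟨_, rfl⟩).trans (le_max_left _ _)
  · simp

theorem contMDiff_cutoff [CompactSpace M] [T2Space L] :
    ContMDiff (cotangentModel F) 𝓘(ℝ, ℝ) ∞ 𝒩.cutoff := by
  have := t2Space_cotangent (F := F) (L := L)
  intro ζ
  by_cases hζ : ζ ∈ 𝒩.ψ.source
  · have h1 : ContMDiffAt (cotangentModel F) 𝓘(ℝ, ℝ) ∞ (fun ζ => 𝒩.f (𝒩.ψ ζ)) ζ :=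
      𝒩.f_smooth.contMDiffAt.comp ζ
        (𝒩.ψ.contMDiffOn.contMDiffAt (𝒩.ψ.open_source.mem_nhds hζ))
    refine h1.congr_of_eventuallyEq ?_
    filter_upwards [𝒩.ψ.open_source.mem_nhds hζ] with ζ' h'
    exact 𝒩.cutoff_of_mem h'
  · -- The preimage of the support of `f` is compact, hence closed in `T^*L`.
    have hK : IsCompact (𝒩.ψ.symm '' tsupport 𝒩.f) :=
      (isClosed_tsupport _).isCompact.image_of_continuousOn
        (𝒩.ψ.symm.contMDiffOn.continuousOn.mono 𝒩.f_supp)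
    have hKs : 𝒩.ψ.symm '' tsupport 𝒩.f ⊆ 𝒩.ψ.source := by
      rintro _ ⟨y, hy, rfl⟩
      exact 𝒩.ψ.map_target (𝒩.f_supp hy)
    refine (contMDiffAt_const (c := (0 : ℝ))).congr_of_eventuallyEq ?_
    filter_upwards [hK.isClosed.isOpen_compl.mem_nhds fun h => hζ (hKs h)] with ζ' h'
    by_contra hne
    have hs := 𝒩.mem_source_of_cutoff_ne_zero hne
    rw [𝒩.cutoff_of_mem hs] at hne
    exact h' ⟨𝒩.ψ ζ', subset_tsupport _ hne, 𝒩.ψ.left_inv hs⟩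

variable [CompactSpace M] [T2Space L]

theorem contDiff_cutoff_line {x : L} (ξ η : TangentSpace 𝓘(ℝ, F) x →L[ℝ] ℝ) :
    ContDiff ℝ ∞ (fun v : ℝ => 𝒩.cutoff ⟨x, ξ + v • η⟩) :=
  (𝒩.contMDiff_cutoff.comp (contMDiff_add_smul (J := 𝓘(ℝ, ℝ)) (b := fun _ : ℝ => x)
    (A := fun _ => ξ) (B := fun _ => η) (c := fun v => v) contMDiff_const contMDiff_const
    contMDiff_id)).contDiff

theorem exists_fiberTime {x : L} (ξ η : TangentSpace 𝓘(ℝ, F) x →L[ℝ] ℝ) :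
    ∃ u : ℝ → ℝ, u 0 = 0 ∧ ∀ t, HasDerivAt u (𝒩.cutoff ⟨x, ξ + u t • η⟩) t := by
  obtain ⟨C, hC⟩ := 𝒩.exists_abs_cutoff_le
  exact exists_scalar_ode ((𝒩.contDiff_cutoff_line ξ η).of_le (by simp)) (fun v => hC _)

/-- The flow line of `f ψ_* X_σ` through `ξ ∈ T_x^*L` is `t ↦ ξ + u(t) η` with `η = σ(x)`, where
`u` is the solution of `u' = f (ψ (ξ + u η))`, `u(0) = 0`. -/
def fiberTime {x : L} (ξ η : TangentSpace 𝓘(ℝ, F) x →L[ℝ] ℝ) : ℝ → ℝ :=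
  (𝒩.exists_fiberTime ξ η).choose

variable {x : L} (ξ η : TangentSpace 𝓘(ℝ, F) x →L[ℝ] ℝ)

theorem fiberTime_zero : 𝒩.fiberTime ξ η 0 = 0 := (𝒩.exists_fiberTime ξ η).choose_spec.1

theorem hasDerivAt_fiberTime (t : ℝ) :
    HasDerivAt (𝒩.fiberTime ξ η) (𝒩.cutoff ⟨x, ξ + 𝒩.fiberTime ξ η t • η⟩) t :=
  (𝒩.exists_fiberTime ξ η).choose_spec.2 t

/-- Solutions of the time-rescaled equation `u' = c f (ψ (ξ + u η))`. -/
theorem eq_fiberTime_mul {c : ℝ} {u : ℝ → ℝ} (h0 : u 0 = 0)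
    (hu : ∀ t ∈ Icc (0 : ℝ) 1, HasDerivAt u (c * 𝒩.cutoff ⟨x, ξ + u t • η⟩) t) :
    u 1 = 𝒩.fiberTime ξ η c := by
  have h := eqOn_of_scalar_ode (g := fun v => c * 𝒩.cutoff ⟨x, ξ + v • η⟩)
    (contDiff_const.mul ((𝒩.contDiff_cutoff_line ξ η).of_le (by simp)))
    (u := u) (v := fun t => 𝒩.fiberTime ξ η (c * t)) (fun t ht => (hu t ht).hasDerivWithinAt)
    (fun t _ => by
      have h1 : HasDerivAt (fun t : ℝ => c * t) c t := by
        simpa using (hasDerivAt_id t).const_mul c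
      have h2 := (𝒩.hasDerivAt_fiberTime ξ η (c * t)).comp t h1
      rw [mul_comm] at h2
      exact h2.hasDerivWithinAt)
    (by simp [h0, fiberTime_zero]) (right_mem_Icc.2 zero_le_one)
  simpa using h

theorem eq_fiberTime_one {u : ℝ → ℝ} (h0 : u 0 = 0)
    (hu : ∀ t ∈ Icc (0 : ℝ) 1, HasDerivAt u (𝒩.cutoff ⟨x, ξ + u t • η⟩) t) :
    u 1 = 𝒩.fiberTime ξ η 1 :=
  𝒩.eq_fiberTime_mul ξ η h0 (by simpa using hu)

/-- Rescaling time amounts to rescaling the section. -/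
theorem mul_fiberTime_smul (c : ℝ) :
    𝒩.fiberTime ξ (c • η) 1 * c = 𝒩.fiberTime ξ η c := by
  refine 𝒩.eq_fiberTime_mul ξ η (u := fun t => 𝒩.fiberTime ξ (c • η) t * c)
    (by simp [fiberTime_zero]) fun t _ => ?_
  refine ((𝒩.hasDerivAt_fiberTime ξ (c • η) t).mul_const c).congr_deriv ?_
  rw [mul_comm, mul_smul]

theorem fiberTime_eq_zero (h : 𝒩.cutoff ⟨x, ξ⟩ = 0) (t : ℝ) : 𝒩.fiberTime ξ η t = 0 :=
  (𝒩.eq_fiberTime_mul ξ η (c := t) (u := fun _ => 0) rfl fun r _ => by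
    simpa [h] using hasDerivAt_const r (0 : ℝ)).symm

/-- Running the flow backwards. -/
theorem fiberTime_neg :
    𝒩.fiberTime (ξ + 𝒩.fiberTime ξ η 1 • η) (-η) 1 = 𝒩.fiberTime ξ η 1 := by
  refine (𝒩.eq_fiberTime_one _ _ (u := fun t => 𝒩.fiberTime ξ η 1 - 𝒩.fiberTime ξ η (1 - t))
    (by simp) fun t _ => ?_).symm.trans (by simp [fiberTime_zero])
  have h1 : HasDerivAt (fun t : ℝ => 1 - t) (-1) t := by
    simpa using (hasDerivAt_id t).const_sub 1
  refine (((𝒩.hasDerivAt_fiberTime ξ η (1 - t)).comp t h1).const_sub _).congr_deriv ?_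
  have : ξ + 𝒩.fiberTime ξ η (1 - t) • η = ξ + 𝒩.fiberTime ξ η 1 • η +
      (𝒩.fiberTime ξ η 1 - 𝒩.fiberTime ξ η (1 - t)) • -η := by module
  rw [this]
  ring

/-- Flow lines that start in `V` stay in `V`. -/
theorem fiberTime_mem_source (h : (⟨x, ξ⟩ : Cotangent F L) ∈ 𝒩.ψ.source) (t : ℝ) :
    (⟨x, ξ + 𝒩.fiberTime ξ η t • η⟩ : Cotangent F L) ∈ 𝒩.ψ.source := by
  by_cases h0 : 𝒩.cutoff ⟨x, ξ + 𝒩.fiberTime ξ η t • η⟩ = 0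
  · -- The flow line ends at a rest point, so it is constant.
    have hz := 𝒩.fiberTime_eq_zero (ξ + 𝒩.fiberTime ξ η t • η) (t • η) h0
    have hback := 𝒩.fiberTime_neg ξ (t • η)
    have hc := 𝒩.mul_fiberTime_smul ξ η t
    have h1 : ξ + 𝒩.fiberTime ξ (t • η) 1 • t • η = ξ + 𝒩.fiberTime ξ η t • η := by
      rw [← hc, mul_smul]
    rw [h1, 𝒩.fiberTime_eq_zero _ _ h0] at hback
    rw [← hc, ← hback]
    simpa using h
  · exact 𝒩.mem_source_of_cutoff_ne_zero h0

/-- On `V'` the flow is the translation by `σ`. -/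
theorem fiberTime_of_segment (h : ∀ t ∈ Icc (0 : ℝ) 1, (⟨x, ξ + t • η⟩ : Cotangent F L) ∈ 𝒩.V') :
    𝒩.fiberTime ξ η 1 = 1 :=
  (𝒩.eq_fiberTime_one ξ η (u := fun t => t) rfl fun t ht => by
    rw [𝒩.cutoff_of_mem_V' (h t ht)]
    exact hasDerivAt_id t).symm

theorem contMDiff_fiberTime [FiniteDimensional ℝ F] {S : ℝ → OneForm F L}
    (hS : ContMDiff (𝓘(ℝ, ℝ).prod 𝓘(ℝ, F)) (cotangentModel F) ∞
      (fun p : ℝ × L => (S p.1).toMap p.2)) :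
    ContMDiff (𝓘(ℝ, ℝ).prod (cotangentModel F)) 𝓘(ℝ, ℝ) ∞
      (fun q : ℝ × Cotangent F L => 𝒩.fiberTime q.2.2 (S q.1 q.2.1) 1) := by
  refine contMDiff_scalar_ode (J := 𝓘(ℝ, ℝ).prod (cotangentModel F))
    (Q := ℝ × Cotangent F L)
    (g := fun p => 𝒩.cutoff ⟨p.1.2.1, p.1.2.2 + p.2 • S p.1.1 p.1.2.1⟩)
    (s := fun q => 𝒩.fiberTime q.2.2 (S q.1 q.2.1)) ?_ (fun q => 𝒩.fiberTime_zero _ _)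
    (fun q t _ => 𝒩.hasDerivAt_fiberTime _ _ t)
  refine 𝒩.contMDiff_cutoff.comp (contMDiff_add_smul
    (b := fun p : (ℝ × Cotangent F L) × ℝ => p.1.2.1)
    (A := fun p => p.1.2.2) (B := fun p => S p.1.1 p.1.2.1) (c := fun p => p.2) ?_ ?_ ?_)
  · exact contMDiff_snd.comp contMDiff_fst
  · exact hS.comp ((contMDiff_fst.comp contMDiff_fst).prodMk
      (contMDiff_cotangent_proj.comp (contMDiff_snd.comp contMDiff_fst)))
  · exact contMDiff_snd

end LagrangianNeighborhood

end VerticalFlow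

/-! ### The flow on the ambient manifold -/

section FlowMap

variable {E : Type*} [NormedAddCommGroup E] [NormedSpace ℝ E]
  {M : Type*} [TopologicalSpace M] [ChartedSpace E M]
  {F : Type*} [NormedAddCommGroup F] [NormedSpace ℝ F]
  {L : Type*} [TopologicalSpace L] [ChartedSpace F L] [IsManifold 𝓘(ℝ, F) ∞ L]
  {Ω : SymplecticForm E M} {ι : L → M}

/-- The velocity of a curve `t ↦ ξ + s(t) σ(x)` in `T_x^*L` is `s'(t) X_σ`. -/
theorem hasMFDerivAt_fiber_line (σ : OneForm F L) {x : L} (ξ : TangentSpace 𝓘(ℝ, F) x →L[ℝ] ℝ)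
    {s : ℝ → ℝ} {s' t : ℝ} (hs : HasDerivAt s s' t) :
    HasMFDerivAt 𝓘(ℝ, ℝ) (cotangentModel F) (fun t => (⟨x, ξ + s t • σ x⟩ : Cotangent F L)) t
      ((1 : ℝ →L[ℝ] ℝ).smulRight
        (s' • (verticalField σ ⟨x, ξ + s t • σ x⟩ : F × (F →L[ℝ] ℝ)))) := by
  let l : ℝ → Cotangent F L := fun r => ⟨x, ξ + s t • σ x + r • σ x⟩
  have hl : ContMDiff 𝓘(ℝ, ℝ) (cotangentModel F) ∞ l :=
    contMDiff_add_smul (J := 𝓘(ℝ, ℝ)) (b := fun _ : ℝ => x) (A := fun _ => ξ + s t • σ x)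
      (B := fun _ => σ x) (c := fun v => v) contMDiff_const contMDiff_const contMDiff_id
  have hc : (fun t => (⟨x, ξ + s t • σ x⟩ : Cotangent F L)) = l ∘ fun r => s r - s t := by
    funext r
    simp only [l, Function.comp]
    congr 1
    module
  have h0 : s t - s t = 0 := sub_self _
  have h1 : HasMFDerivAt 𝓘(ℝ, ℝ) (cotangentModel F) l (s t - s t)
      (mfderiv 𝓘(ℝ, ℝ) (cotangentModel F) l 0) := by
    rw [h0]
    exact (hl.mdifferentiableAt (by simp)).hasMFDerivAt
  have h2 : HasMFDerivAt 𝓘(ℝ, ℝ) 𝓘(ℝ, ℝ) (fun r => s r - s t) t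
      ((1 : ℝ →L[ℝ] ℝ).smulRight s') := (hs.sub_const _).hasFDerivAt.hasMFDerivAt
  rw [hc]
  refine (h1.comp t h2).congr_mfderiv ?_
  ext1
  let D : ℝ →L[ℝ] F × (F →L[ℝ] ℝ) := mfderiv 𝓘(ℝ, ℝ) (cotangentModel F) l 0
  change D ((1 : ℝ) * s') = (1 : ℝ) • s' • D 1
  rw [one_mul, one_smul, ← D.map_smul, smul_eq_mul, mul_one]

/-- Affine families of sections are smooth. -/
theorem contMDiff_section_add_smul (σ τ : OneForm F L) {c : ℝ → ℝ} (hc : ContDiff ℝ ∞ c) :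
    ContMDiff (𝓘(ℝ, ℝ).prod 𝓘(ℝ, F)) (cotangentModel F) ∞
      (fun p : ℝ × L => (σ + c p.1 • τ).toMap p.2) :=
  contMDiff_add_smul (b := fun p : ℝ × L => p.2) (A := fun p => σ p.2) (B := fun p => τ p.2)
    (c := fun p => c p.1) (σ.contMDiff.comp contMDiff_snd) (τ.contMDiff.comp contMDiff_snd)
    (hc.contMDiff.comp contMDiff_fst)

namespace LagrangianNeighborhood

variable (𝒩 : LagrangianNeighborhood (F := F) Ω ι)

/-- The vector field `f ψ_* X_σ` on `M`. -/
def sectionField (σ : OneForm F L) (y : M) : TangentSpace 𝓘(ℝ, E) y :=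
  𝒩.f y • (mfderiv (cotangentModel F) 𝓘(ℝ, E) 𝒩.ψ (𝒩.ψ.symm y)
    (verticalField σ (𝒩.ψ.symm y)) : E)

theorem exists_eq_of_mem_target {y : M} (h : y ∈ 𝒩.ψ.target) : ∃ ζ ∈ 𝒩.ψ.source, 𝒩.ψ ζ = y :=
  ⟨_, 𝒩.ψ.map_target h, 𝒩.ψ.right_inv h⟩

variable [CompactSpace M] [T2Space L]

/-- The flow of the section `σ` on `T^*L`: `ξ ↦ ξ + u(1) σ(x)` for `ξ ∈ T_x^*L`. -/
def fiberFlow (σ : OneForm F L) (ζ : Cotangent F L) : Cotangent F L :=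
  ⟨ζ.1, ζ.2 + 𝒩.fiberTime ζ.2 (σ ζ.1) 1 • σ ζ.1⟩

open Classical in
/-- The flow at time `1` of `f ψ_* X_σ` on `M`. -/
def flowMap (σ : OneForm F L) (y : M) : M :=
  if y ∈ 𝒩.ψ.target then 𝒩.ψ (𝒩.fiberFlow σ (𝒩.ψ.symm y)) else y

theorem fiberFlow_mem_source (σ : OneForm F L) {ζ : Cotangent F L} (h : ζ ∈ 𝒩.ψ.source) :
    𝒩.fiberFlow σ ζ ∈ 𝒩.ψ.source :=
  𝒩.fiberTime_mem_source ζ.2 (σ ζ.1) h 1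

theorem flowMap_of_mem (σ : OneForm F L) {y : M} (h : y ∈ 𝒩.ψ.target) :
    𝒩.flowMap σ y = 𝒩.ψ (𝒩.fiberFlow σ (𝒩.ψ.symm y)) := if_pos h

theorem flowMap_of_notMem (σ : OneForm F L) {y : M} (h : y ∉ 𝒩.ψ.target) :
    𝒩.flowMap σ y = y := if_neg h

theorem flowMap_apply (σ : OneForm F L) {ζ : Cotangent F L} (h : ζ ∈ 𝒩.ψ.source) :
    𝒩.flowMap σ (𝒩.ψ ζ) = 𝒩.ψ (𝒩.fiberFlow σ ζ) := by
  rw [𝒩.flowMap_of_mem σ (𝒩.ψ.map_source h)]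
  exact congrArg (fun z => 𝒩.ψ (𝒩.fiberFlow σ z)) (𝒩.ψ.left_inv h)

theorem flowMap_of_f_eq_zero (σ : OneForm F L) {y : M} (h : 𝒩.f y = 0) : 𝒩.flowMap σ y = y := by
  by_cases hy : y ∈ 𝒩.ψ.target
  · obtain ⟨⟨x, ξ⟩, hζ, rfl⟩ := 𝒩.exists_eq_of_mem_target hy
    rw [𝒩.flowMap_apply σ hζ]
    rw [← 𝒩.cutoff_of_mem hζ] at h
    simp only [fiberFlow, 𝒩.fiberTime_eq_zero ξ (σ x) h, zero_smul, add_zero]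
  · exact 𝒩.flowMap_of_notMem σ hy

theorem fiberFlow_neg (σ : OneForm F L) (ζ : Cotangent F L) :
    𝒩.fiberFlow (-σ) (𝒩.fiberFlow σ ζ) = ζ := by
  obtain ⟨x, ξ⟩ := ζ
  have h : ξ + 𝒩.fiberTime ξ (σ x) 1 • σ x +
      𝒩.fiberTime (ξ + 𝒩.fiberTime ξ (σ x) 1 • σ x) (-σ x) 1 • -σ x = ξ := by
    rw [𝒩.fiberTime_neg, smul_neg, add_neg_cancel_right]
  exact congrArg (TotalSpace.mk x) h

theorem flowMap_neg (σ : OneForm F L) (y : M) : 𝒩.flowMap (-σ) (𝒩.flowMap σ y) = y := by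
  by_cases hy : y ∈ 𝒩.ψ.target
  · obtain ⟨ζ, hζ, rfl⟩ := 𝒩.exists_eq_of_mem_target hy
    rw [𝒩.flowMap_apply σ hζ, 𝒩.flowMap_apply _ (𝒩.fiberFlow_mem_source σ hζ), fiberFlow_neg]
  · rw [𝒩.flowMap_of_notMem σ hy, 𝒩.flowMap_of_notMem _ hy]

theorem flowMap_zero (y : M) : 𝒩.flowMap (0 : OneForm F L) y = y := by
  by_cases hy : y ∈ 𝒩.ψ.target
  · obtain ⟨⟨x, ξ⟩, hζ, rfl⟩ := 𝒩.exists_eq_of_mem_target hy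
    have hσ : (0 : OneForm F L) x = 0 := rfl
    rw [𝒩.flowMap_apply _ hζ]
    simp only [fiberFlow, hσ, smul_zero, add_zero]
  · exact 𝒩.flowMap_of_notMem _ hy

theorem flowMap_zero_smul (σ : OneForm F L) (y : M) : 𝒩.flowMap ((0 : ℝ) • σ) y = y := by
  have h : (0 : ℝ) • σ = 0 := ContMDiffSection.ext fun x => zero_smul ℝ (σ x)
  rw [h, flowMap_zero]

/-- The flow maps `L` onto the image of `ψ ∘ σ`. -/
theorem flowMap_ι {σ : OneForm F L} (hσ : ∀ x, σ.toMap x ∈ 𝒩.V') (x : L) :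
    𝒩.flowMap σ (ι x) = 𝒩.ψ (σ.toMap x) := by
  rw [← 𝒩.ψ_zero, 𝒩.flowMap_apply σ (𝒩.zero_mem x)]
  have h1 : 𝒩.fiberTime (x := x) 0 (σ x) 1 = 1 := by
    refine 𝒩.fiberTime_of_segment _ _ fun t ht => ?_
    have hc := 𝒩.fiberwise_convex x (𝒩.zero_mem_V' x) (hσ x) (a := 1 - t) (b := t)
      (by linarith [ht.2]) ht.1 (by ring)
    rw [smul_zero] at hc
    exact hc
  simp only [fiberFlow, h1, one_smul, zero_add, OneForm.toMap]

theorem image_flowMap {σ : OneForm F L} {S : Set M} (hσ : 𝒩.Represents σ S) :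
    𝒩.flowMap σ '' range ι = S := by
  rw [← hσ.2, ← range_comp]
  exact congrArg range (funext fun x => 𝒩.flowMap_ι hσ.1 x)

/-- The curves `t ↦ flowMap (t σ) y` are integral curves of `f ψ_* X_σ`. -/
theorem isMIntegralCurve_flowMap (σ : OneForm F L) (y : M) :
    IsMIntegralCurve (I := 𝓘(ℝ, E)) (fun t : ℝ => 𝒩.flowMap (t • σ) y) (𝒩.sectionField σ) := by
  by_cases hy : y ∈ 𝒩.ψ.target
  · obtain ⟨⟨x, ξ⟩, hζ, rfl⟩ := 𝒩.exists_eq_of_mem_target hy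
    let c : ℝ → Cotangent F L := fun t => ⟨x, ξ + 𝒩.fiberTime ξ (σ x) t • σ x⟩
    have hcs : ∀ t, c t ∈ 𝒩.ψ.source := 𝒩.fiberTime_mem_source ξ (σ x) hζ
    have hγ : (fun t : ℝ => 𝒩.flowMap (t • σ) (𝒩.ψ ⟨x, ξ⟩)) = 𝒩.ψ ∘ c := by
      funext t
      rw [𝒩.flowMap_apply _ hζ]
      refine congrArg 𝒩.ψ ?_
      have hσ : (t • σ) x = t • σ x := rfl
      simp only [fiberFlow, hσ, c]
      rw [smul_smul, 𝒩.mul_fiberTime_smul]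
    rw [hγ]
    intro t
    have h1 := hasMFDerivAt_fiber_line σ ξ (𝒩.hasDerivAt_fiberTime ξ (σ x) t)
    have h2 := (𝒩.ψ.mdifferentiableAt (by simp) (hcs t)).hasMFDerivAt
    refine (h2.comp t h1).congr_mfderiv ?_
    let A : Cotangent F L → E := fun ζ =>
      mfderiv (cotangentModel F) 𝓘(ℝ, E) 𝒩.ψ ζ (verticalField σ ζ)
    have hA : A (𝒩.ψ.symm (𝒩.ψ (c t))) = A (c t) := congrArg A (𝒩.ψ.left_inv (hcs t))
    ext1
    let D : F × (F →L[ℝ] ℝ) →L[ℝ] E := mfderiv (cotangentModel F) 𝓘(ℝ, E) 𝒩.ψ (c t)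
    change D ((1 : ℝ) • 𝒩.cutoff (c t) • (verticalField σ (c t) : F × (F →L[ℝ] ℝ))) =
      (1 : ℝ) • 𝒩.f (𝒩.ψ (c t)) • A (𝒩.ψ.symm (𝒩.ψ (c t)))
    have hD : D (𝒩.cutoff (c t) • (verticalField σ (c t) : F × (F →L[ℝ] ℝ))) =
        𝒩.cutoff (c t) • A (c t) := D.map_smul _ _
    rw [hA, one_smul, one_smul, hD, 𝒩.cutoff_of_mem (hcs t)]
  · have hf : 𝒩.f y = 0 := by
      by_contra h
      exact hy (𝒩.f_supp (subset_tsupport _ h))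
    have hγ : (fun t : ℝ => 𝒩.flowMap (t • σ) y) = fun _ => y :=
      funext fun t => 𝒩.flowMap_of_notMem _ hy
    rw [hγ]
    refine isMIntegralCurve_const ?_
    rw [sectionField, hf]
    exact zero_smul ℝ (_ : E)

variable [FiniteDimensional ℝ F]

/-- The flow depends smoothly on the section. -/
theorem contMDiff_flowMap {S : ℝ → OneForm F L}
    (hS : ContMDiff (𝓘(ℝ, ℝ).prod 𝓘(ℝ, F)) (cotangentModel F) ∞
      (fun p : ℝ × L => (S p.1).toMap p.2)) :
    ContMDiff (𝓘(ℝ, ℝ).prod 𝓘(ℝ, E)) 𝓘(ℝ, E) ∞ (fun p : ℝ × M => 𝒩.flowMap (S p.1) p.2) := by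
  have hZ : ContMDiff (𝓘(ℝ, ℝ).prod (cotangentModel F)) (cotangentModel F) ∞
      (fun q : ℝ × Cotangent F L => 𝒩.fiberFlow (S q.1) q.2) := by
    refine contMDiff_add_smul (b := fun q : ℝ × Cotangent F L => q.2.1) (A := fun q => q.2.2)
      (B := fun q => S q.1 q.2.1) (c := fun q => 𝒩.fiberTime q.2.2 (S q.1 q.2.1) 1)
      contMDiff_snd ?_ (𝒩.contMDiff_fiberTime hS)
    exact hS.comp (contMDiff_fst.prodMk (contMDiff_cotangent_proj.comp contMDiff_snd))
  rintro ⟨t, y⟩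
  by_cases hy : y ∈ 𝒩.ψ.target
  · have hs : 𝒩.ψ.symm y ∈ 𝒩.ψ.source := 𝒩.ψ.map_target hy
    have h1 : ContMDiffAt (𝓘(ℝ, ℝ).prod 𝓘(ℝ, E)) (cotangentModel F) ∞
        (fun p : ℝ × M => 𝒩.ψ.symm p.2) (t, y) :=
      (𝒩.ψ.symm.contMDiffOn.contMDiffAt (𝒩.ψ.open_target.mem_nhds hy)).comp (t, y) contMDiffAt_snd
    have h2 : ContMDiffAt (𝓘(ℝ, ℝ).prod 𝓘(ℝ, E)) (cotangentModel F) ∞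
        (fun p : ℝ × M => 𝒩.fiberFlow (S p.1) (𝒩.ψ.symm p.2)) (t, y) :=
      (hZ (t, 𝒩.ψ.symm y)).comp (t, y) (contMDiffAt_fst.prodMk h1)
    have h3 := (𝒩.ψ.contMDiffOn.contMDiffAt (𝒩.ψ.open_source.mem_nhds
      (𝒩.fiberFlow_mem_source (S t) hs))).comp (t, y) h2
    refine h3.congr_of_eventuallyEq ?_
    filter_upwards [continuousAt_snd.eventually (𝒩.ψ.open_target.mem_nhds hy)] with p hp
    exact 𝒩.flowMap_of_mem _ hp
  · have hy' : y ∈ (tsupport 𝒩.f)ᶜ := fun h => hy (𝒩.f_supp h)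
    refine (contMDiffAt_snd (M := ℝ)).congr_of_eventuallyEq ?_
    filter_upwards [continuousAt_snd.eventually
      ((isClosed_tsupport 𝒩.f).isOpen_compl.mem_nhds hy')] with p hp
    exact 𝒩.flowMap_of_f_eq_zero _ (image_eq_zero_of_notMem_tsupport hp)

theorem contMDiff_flowMap_section (σ : OneForm F L) :
    ContMDiff 𝓘(ℝ, E) 𝓘(ℝ, E) ∞ (𝒩.flowMap σ) :=
  (𝒩.contMDiff_flowMap (S := fun _ => σ) (σ.contMDiff.comp contMDiff_snd)).comp
    (contMDiff_const.prodMk contMDiff_id : ContMDiff _ (𝓘(ℝ, ℝ).prod 𝓘(ℝ, E)) ∞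
      fun y : M => ((0 : ℝ), y))

/-- The flow of a section as a diffeomorphism; its inverse is the flow of `-σ`. -/
def flowDiffeo (σ : OneForm F L) : M ≃ₘ^∞⟮𝓘(ℝ, E), 𝓘(ℝ, E)⟯ M where
  toFun := 𝒩.flowMap σ
  invFun := 𝒩.flowMap (-σ)
  left_inv := 𝒩.flowMap_neg σ
  right_inv := fun y => by simpa using 𝒩.flowMap_neg (-σ) y
  contMDiff_toFun := 𝒩.contMDiff_flowMap_section σ
  contMDiff_invFun := 𝒩.contMDiff_flowMap_section (-σ)

theorem contMDiff_flowMap_smul (σ : OneForm F L) :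
    ContMDiff (𝓘(ℝ, ℝ).prod 𝓘(ℝ, E)) 𝓘(ℝ, E) ∞ (fun p : ℝ × M => 𝒩.flowMap (p.1 • σ) p.2) :=
  𝒩.contMDiff_flowMap (S := fun t => t • σ) (by
    simpa using contMDiff_section_add_smul (0 : OneForm F L) σ contDiff_id)

theorem isIsotopy_flowDiffeo (σ : OneForm F L) : IsIsotopy fun t => 𝒩.flowDiffeo (t • σ) where
  smooth := (𝒩.contMDiff_flowMap_smul σ).contMDiffOn
  zero := 𝒩.flowMap_zero_smul σ

variable [IsManifold 𝓘(ℝ, E) ∞ M]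

/-- The vector field is the initial velocity of a smooth flow, hence smooth. -/
theorem contMDiff_sectionField (σ : OneForm F L) :
    ContMDiff 𝓘(ℝ, E) 𝓘(ℝ, E).tangent 1
      (fun y => (⟨y, 𝒩.sectionField σ y⟩ : TangentBundle 𝓘(ℝ, E) M)) := by
  have : IsManifold 𝓘(ℝ, E) 1 M := .of_le (n := ∞) (by simp)
  let Θ : ℝ × M → M := fun p => 𝒩.flowMap (p.1 • σ) p.2
  have hΘ : ContMDiff (𝓘(ℝ, ℝ).prod 𝓘(ℝ, E)) 𝓘(ℝ, E) ∞ Θ := 𝒩.contMDiff_flowMap_smul σ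
  have hT := hΘ.contMDiff_tangentMap (m := 1) (by norm_num; exact ENat.LEInfty.out)
  let sec : M → TangentBundle 𝓘(ℝ, ℝ) ℝ × TangentBundle 𝓘(ℝ, E) M := fun y =>
    (⟨0, (1 : ℝ)⟩, zeroSection E (TangentSpace 𝓘(ℝ, E)) y)
  have hsec : ContMDiff 𝓘(ℝ, E) (𝓘(ℝ, ℝ).tangent.prod 𝓘(ℝ, E).tangent) 1 sec :=
    contMDiff_const.prodMk (contMDiff_zeroSection ℝ (TangentSpace 𝓘(ℝ, E)))
  have hcomp := hT.comp (contMDiff_equivTangentBundleProd_symm.comp hsec)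
  refine hcomp.congr fun y => ?_
  have hγ := 𝒩.isMIntegralCurve_flowMap σ y 0
  have h0 : Θ (0, y) = y := 𝒩.flowMap_zero_smul σ y
  let X : M → TangentBundle 𝓘(ℝ, E) M := fun y => ⟨y, 𝒩.sectionField σ y⟩
  have hX : X (Θ (0, y)) = X y := congrArg X h0
  refine hX.symm.trans ?_
  have hc : HasMFDerivAt 𝓘(ℝ, ℝ) (𝓘(ℝ, ℝ).prod 𝓘(ℝ, E)) (fun t : ℝ => (t, y)) 0
      (ContinuousLinearMap.inl ℝ ℝ E) :=
    (hasMFDerivAt_id (0 : ℝ)).prodMk (hasMFDerivAt_const y 0)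
  have hd := ((hΘ.mdifferentiableAt (x := (0, y)) (by simp)).hasMFDerivAt.comp 0 hc)
  have heq := hasMFDerivAt_unique hγ hd
  have hv := congrArg (fun A : ℝ →L[ℝ] E => A 1) heq
  have hv' : (mfderiv (𝓘(ℝ, ℝ).prod 𝓘(ℝ, E)) 𝓘(ℝ, E) Θ (0, y) : ℝ × E →L[ℝ] E) (1, 0) =
      (𝒩.sectionField σ (Θ (0, y)) : E) := by
    refine Eq.trans hv.symm ?_
    exact one_smul ℝ (𝒩.sectionField σ (Θ (0, y)) : E)
  exact congrArg (fun v : E => (⟨Θ (0, y), v⟩ : TangentBundle 𝓘(ℝ, E) M)) hv'.symm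

/-- Integral curves of the smooth field `f ψ_* X_σ` are unique, so the chosen integral curve in
`timeOneFlow` is the explicit one. -/
theorem timeOneFlow_sectionField [T2Space M] (σ : OneForm F L) :
    timeOneFlow (𝒩.sectionField σ) = 𝒩.flowMap σ := by
  funext y
  have hγ := 𝒩.isMIntegralCurve_flowMap σ y
  have h0 := 𝒩.flowMap_zero_smul σ y
  have h : ∃ γ : ℝ → M, γ 0 = y ∧ IsMIntegralCurve (I := 𝓘(ℝ, E)) γ (𝒩.sectionField σ) :=
    ⟨_, h0, hγ⟩
  have : IsManifold 𝓘(ℝ, E) 1 M := .of_le (n := ∞) (by simp)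
  rw [timeOneFlow, dif_pos h]
  have := isMIntegralCurve_Ioo_eq_of_contMDiff_boundaryless (t₀ := 0)
    (𝒩.contMDiff_sectionField σ) h.choose_spec.2 hγ (h.choose_spec.1.trans h0.symm)
  have h1 : (1 : ℝ) • σ = σ := ContMDiffSection.ext fun x => one_smul ℝ (σ x)
  rw [this]
  exact congrArg (fun τ => 𝒩.flowMap τ y) h1

theorem phi_eq_flowMap [T2Space M] (L' : 𝒩.chartNhd) :
    𝒩.phi L' = 𝒩.flowMap (𝒩.sectionOf L') :=
  𝒩.timeOneFlow_sectionField _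

end LagrangianNeighborhood

end FlowMap

/-! ### Isotopies -/

section Isotopy

variable {E : Type*} [NormedAddCommGroup E] [NormedSpace ℝ E]
  {M : Type*} [TopologicalSpace M] [ChartedSpace E M]

theorem smoothTransition_mem_Icc (t : ℝ) : Real.smoothTransition t ∈ Icc (0 : ℝ) 1 :=
  ⟨Real.smoothTransition.nonneg t, Real.smoothTransition.le_one t⟩

namespace IsIsotopy

variable {φ φ' : ℝ → (M ≃ₘ^∞⟮𝓘(ℝ, E), 𝓘(ℝ, E)⟯ M)}

theorem refl : IsIsotopy fun _ : ℝ => Diffeomorph.refl 𝓘(ℝ, E) M ∞ :=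
  ⟨contMDiff_snd.contMDiffOn, fun _ => rfl⟩

/-- A reparametrization of an isotopy by a function with values in `[0,1]` is smooth for all
times. -/
theorem contMDiff_comp (h : IsIsotopy φ) {β : ℝ → ℝ} (hβ : ContDiff ℝ ∞ β)
    (hmem : ∀ t, β t ∈ Icc (0 : ℝ) 1) :
    ContMDiff (𝓘(ℝ, ℝ).prod 𝓘(ℝ, E)) 𝓘(ℝ, E) ∞ (fun p : ℝ × M => φ (β p.1) p.2) :=
  h.smooth.comp_contMDiff ((hβ.contMDiff.comp contMDiff_fst).prodMk contMDiff_snd)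
    fun p => ⟨hmem p.1, mem_univ _⟩

theorem contMDiff_smoothTransition (h : IsIsotopy φ) :
    ContMDiff (𝓘(ℝ, ℝ).prod 𝓘(ℝ, E)) 𝓘(ℝ, E) ∞
      (fun p : ℝ × M => φ (Real.smoothTransition p.1) p.2) :=
  h.contMDiff_comp Real.smoothTransition.contDiff smoothTransition_mem_Icc

theorem symm (h : IsIsotopy φ) : IsIsotopy fun t => (φ 1).symm.trans (φ (1 - t)) where
  smooth := by
    refine h.smooth.comp (g := fun p : ℝ × M => φ p.1 p.2)
      (f := fun p : ℝ × M => (1 - p.1, (φ 1).symm p.2)) ?_ ?_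
    · have h1 : ContDiff ℝ ∞ fun t : ℝ => 1 - t := contDiff_const.sub contDiff_id
      exact ((h1.contMDiff.comp contMDiff_fst).prodMk
        ((φ 1).symm.contMDiff.comp contMDiff_snd)).contMDiffOn
    · rintro p ⟨hp, -⟩
      exact ⟨⟨by linarith [hp.2], by linarith [hp.1]⟩, mem_univ _⟩
  zero := fun x => by simp

/-- Concatenation of isotopies. Both are reparametrized so as to be constant near the time at
which they are glued. -/
theorem trans (h : IsIsotopy φ) (h' : IsIsotopy φ') :
    IsIsotopy fun t => (φ (Real.smoothTransition (2 * t))).trans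
      (φ' (Real.smoothTransition (2 * t - 1))) where
  smooth := by
    have h1 : ContDiff ℝ ∞ fun t : ℝ => Real.smoothTransition (2 * t) :=
      Real.smoothTransition.contDiff.comp (contDiff_const.mul contDiff_id)
    have h2 : ContDiff ℝ ∞ fun t : ℝ => Real.smoothTransition (2 * t - 1) :=
      Real.smoothTransition.contDiff.comp ((contDiff_const.mul contDiff_id).sub contDiff_const)
    exact ((h'.contMDiff_comp h2 fun t => smoothTransition_mem_Icc _).comp
      (contMDiff_fst.prodMk
        (h.contMDiff_comp h1 fun t => smoothTransition_mem_Icc _))).contMDiffOn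
  zero := fun x => by
    have : Real.smoothTransition (-1) = 0 := Real.smoothTransition.zero_of_nonpos (by norm_num)
    simp [this, h.zero, h'.zero]

/-- At each time, a concatenation is either at a stage of the first isotopy or at a stage of the
second one after completion of the first. -/
theorem trans_cases (h' : IsIsotopy φ') (t : ℝ) :
    ((φ (Real.smoothTransition (2 * t))).trans (φ' (Real.smoothTransition (2 * t - 1))) : M → M) =
        φ (Real.smoothTransition (2 * t)) ∨
      ((φ (Real.smoothTransition (2 * t))).trans (φ' (Real.smoothTransition (2 * t - 1))) :
        M → M) = φ' (Real.smoothTransition (2 * t - 1)) ∘ φ 1 := by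
  rcases le_total (2 * t) 1 with ht | ht
  · left
    rw [Real.smoothTransition.zero_of_nonpos (x := 2 * t - 1) (by linarith)]
    funext x
    simp [h'.zero]
  · right
    rw [Real.smoothTransition.one_of_one_le ht]
    rfl

end IsIsotopy

end Isotopy

/-! ### Submanifolds near `L` as sections of `T^*L` -/

section Sections

variable {E : Type*} [NormedAddCommGroup E] [NormedSpace ℝ E]
  {M : Type*} [TopologicalSpace M] [ChartedSpace E M]
  {F : Type*} [NormedAddCommGroup F] [NormedSpace ℝ F]
  {L : Type*} [TopologicalSpace L] [ChartedSpace F L] [IsManifold 𝓘(ℝ, F) ∞ L]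
  {Ω : SymplecticForm E M} {ι : L → M}

namespace LagrangianNeighborhood

variable {𝒩 : LagrangianNeighborhood (F := F) Ω ι}

theorem Represents.mem_source {σ : OneForm F L} {S : Set M} (h : 𝒩.Represents σ S) (x : L) :
    σ.toMap x ∈ 𝒩.ψ.source :=
  𝒩.closure_V' (subset_closure (h.1 x))

theorem Represents.symm_ψ {σ : OneForm F L} {S : Set M} (h : 𝒩.Represents σ S) (x : L) :
    𝒩.ψ.symm (𝒩.ψ (σ.toMap x)) = σ.toMap x :=
  𝒩.ψ.left_inv (h.mem_source x)

/-- A section is determined by its image. -/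
theorem Represents.unique {σ τ : OneForm F L} {S : Set M} (h : 𝒩.Represents σ S)
    (h' : 𝒩.Represents τ S) : σ = τ := by
  refine ContMDiffSection.ext fun x => ?_
  obtain ⟨x', hx'⟩ : 𝒩.ψ (σ.toMap x) ∈ range fun x => 𝒩.ψ (τ.toMap x) := by
    rw [h'.2, ← h.2]
    exact ⟨x, rfl⟩
  have heq : τ.toMap x' = σ.toMap x := by
    rw [← h'.symm_ψ x', ← h.symm_ψ x]
    exact congrArg 𝒩.ψ.symm hx'
  obtain rfl : x' = x := congrArg TotalSpace.proj heq
  exact (TotalSpace.mk_inj.1 heq).symm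

theorem represents_sectionOf (L' : 𝒩.chartNhd) : 𝒩.Represents (𝒩.sectionOf L') L' :=
  L'.2.choose_spec

theorem Represents.sectionOf_eq {σ : OneForm F L} {L' : 𝒩.chartNhd}
    (h : 𝒩.Represents σ (L' : Set M)) : 𝒩.sectionOf L' = σ :=
  (represents_sectionOf L').unique h

variable (𝒩) in
theorem represents_zero : 𝒩.Represents 0 (range ι) :=
  ⟨fun x => 𝒩.zero_mem_V' x, congrArg range (funext fun x => 𝒩.ψ_zero x)⟩

/-- Since `V'` is fiberwise convex, segments of sections with values in `V'` stay in `V'`. -/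
theorem Represents.segment {σ τ : OneForm F L} {S S' : Set M} (h : 𝒩.Represents σ S)
    (h' : 𝒩.Represents τ S') {t : ℝ} (ht : t ∈ Icc (0 : ℝ) 1) (x : L) :
    (σ + t • (τ - σ)).toMap x ∈ 𝒩.V' := by
  have hc := 𝒩.fiberwise_convex x (h.1 x) (h'.1 x) (a := 1 - t) (b := t)
    (by linarith [ht.2]) ht.1 (by ring)
  have he : (1 - t) • σ x + t • τ x = σ x + t • (τ x - σ x) := by module
  rw [he] at hc
  exact hc

/-- If diffeomorphisms `φ_t` that depend smoothly on `t` carry the image of a section to images of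
sections `σ_t`, then `σ_t` depends smoothly on `t`: if `g_t = ψ⁻¹ ∘ φ_t ∘ ψ ∘ σ` and
`h_t = p ∘ g_t`, where `p : T^*L → L`, then `σ_t = g_t ∘ h_t⁻¹`, and the inverse function theorem
applies to `(t, x) ↦ (t, h_t(x))`. -/
theorem Represents.contMDiff_family [FiniteDimensional ℝ F]
    {φ : ℝ → (M ≃ₘ^∞⟮𝓘(ℝ, E), 𝓘(ℝ, E)⟯ M)}
    (hφ : ContMDiff (𝓘(ℝ, ℝ).prod 𝓘(ℝ, E)) 𝓘(ℝ, E) ∞ (fun p : ℝ × M => φ p.1 p.2))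
    {σ : OneForm F L} {S : Set M} (hσ : 𝒩.Represents σ S)
    {τ : ℝ → OneForm F L} (hτ : ∀ t, 𝒩.Represents (τ t) (φ t '' S)) :
    ContMDiff (𝓘(ℝ, ℝ).prod 𝓘(ℝ, F)) (cotangentModel F) ∞
      (fun p : ℝ × L => (τ p.1).toMap p.2) := by
  let g : ℝ × L → Cotangent F L := fun p => 𝒩.ψ.symm (φ p.1 (𝒩.ψ (σ.toMap p.2)))
  have hrange : ∀ p : ℝ × L, ∃ x', 𝒩.ψ ((τ p.1).toMap x') = φ p.1 (𝒩.ψ (σ.toMap p.2)) := fun p => by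
    have hm : φ p.1 (𝒩.ψ (σ.toMap p.2)) ∈ φ p.1 '' S := ⟨_, hσ.2 ▸ ⟨p.2, rfl⟩, rfl⟩
    rwa [← (hτ p.1).2] at hm
  have hrange' : ∀ p : ℝ × L, ∃ x', φ p.1 (𝒩.ψ (σ.toMap x')) =
      𝒩.ψ ((τ p.1).toMap p.2) := fun p => by
    have hm : 𝒩.ψ ((τ p.1).toMap p.2) ∈ φ p.1 '' S := (hτ p.1).2 ▸ ⟨p.2, rfl⟩
    rw [← hσ.2] at hm
    obtain ⟨_, ⟨x', rfl⟩, h⟩ := hm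
    exact ⟨x', h⟩
  have hg_mem : ∀ p : ℝ × L, φ p.1 (𝒩.ψ (σ.toMap p.2)) ∈ 𝒩.ψ.target := fun p => by
    obtain ⟨x', hx'⟩ := hrange p
    rw [← hx']
    exact 𝒩.ψ.map_source ((hτ p.1).mem_source x')
  have hψg : ∀ p, 𝒩.ψ (g p) = φ p.1 (𝒩.ψ (σ.toMap p.2)) := fun p => 𝒩.ψ.right_inv (hg_mem p)
  have hgτ : ∀ p : ℝ × L, (τ p.1).toMap (g p).1 = g p := fun p => by
    obtain ⟨x', hx'⟩ := hrange p
    have h1 : g p = (τ p.1).toMap x' := by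
      rw [← (hτ p.1).symm_ψ x']
      exact congrArg 𝒩.ψ.symm hx'.symm
    rw [h1]
    rfl
  have hg : ContMDiff (𝓘(ℝ, ℝ).prod 𝓘(ℝ, F)) (cotangentModel F) ∞ g := fun p => by
    have h1 : ContMDiffAt (𝓘(ℝ, ℝ).prod 𝓘(ℝ, F)) 𝓘(ℝ, E) ∞
        (fun p : ℝ × L => 𝒩.ψ (σ.toMap p.2)) p :=
      (𝒩.ψ.contMDiffOn.contMDiffAt (𝒩.ψ.open_source.mem_nhds (hσ.mem_source p.2))).comp p
        (σ.contMDiff.contMDiffAt.comp p contMDiffAt_snd)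
    have h2 : ContMDiffAt (𝓘(ℝ, ℝ).prod 𝓘(ℝ, F)) 𝓘(ℝ, E) ∞
        (fun p : ℝ × L => φ p.1 (𝒩.ψ (σ.toMap p.2))) p :=
      (hφ (p.1, 𝒩.ψ (σ.toMap p.2))).comp p (contMDiffAt_fst.prodMk h1)
    exact (𝒩.ψ.symm.contMDiffOn.contMDiffAt (𝒩.ψ.open_target.mem_nhds (hg_mem p))).comp p h2
  let k : ℝ → L → L := fun t x => (𝒩.ψ.symm ((φ t).symm (𝒩.ψ ((τ t).toMap x)))).1
  have hsymm : ∀ p : ℝ × L, ∀ x', φ p.1 (𝒩.ψ (σ.toMap x')) = 𝒩.ψ ((τ p.1).toMap p.2) →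
      𝒩.ψ.symm ((φ p.1).symm (𝒩.ψ ((τ p.1).toMap p.2))) = σ.toMap x' := fun p x' hx' => by
    rw [← hx', Diffeomorph.symm_apply_apply]
    exact hσ.symm_ψ x'
  have hk : ∀ t, ContMDiff 𝓘(ℝ, F) 𝓘(ℝ, F) ∞ (k t) := fun t x => by
    obtain ⟨x', hx'⟩ := hrange' (t, x)
    have hm : (φ t).symm (𝒩.ψ ((τ t).toMap x)) ∈ 𝒩.ψ.target := by
      have : φ t (𝒩.ψ (σ.toMap x')) = 𝒩.ψ ((τ t).toMap x) := hx'
      rw [← this, Diffeomorph.symm_apply_apply]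
      exact 𝒩.ψ.map_source (hσ.mem_source x')
    have h1 : ContMDiffAt 𝓘(ℝ, F) 𝓘(ℝ, E) ∞ (fun x => 𝒩.ψ ((τ t).toMap x)) x :=
      (𝒩.ψ.contMDiffOn.contMDiffAt (𝒩.ψ.open_source.mem_nhds ((hτ t).mem_source x))).comp x
        (τ t).contMDiff.contMDiffAt
    have h2 := (φ t).symm.contMDiff.contMDiffAt.comp x h1
    have h3 := (𝒩.ψ.symm.contMDiffOn.contMDiffAt (𝒩.ψ.open_target.mem_nhds hm)).comp x h2
    exact contMDiff_cotangent_proj.contMDiffAt.comp x h3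
  have hkg : ∀ t x, k t (g (t, x)).1 = x := fun t x => by
    have h1 : φ t (𝒩.ψ (σ.toMap x)) = 𝒩.ψ ((τ t).toMap (g (t, x)).1) := by
      rw [hgτ (t, x), hψg]
    exact congrArg TotalSpace.proj (hsymm (t, (g (t, x)).1) x h1)
  let H : ℝ × L → ℝ × L := fun p => (p.1, (g p).1)
  let K : ℝ × L → ℝ × L := fun p => (p.1, k p.1 p.2)
  have hH : ContMDiff (𝓘(ℝ, ℝ).prod 𝓘(ℝ, F)) (𝓘(ℝ, ℝ).prod 𝓘(ℝ, F)) ∞ H :=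
    contMDiff_fst.prodMk (contMDiff_cotangent_proj.comp hg)
  have hKH : Function.LeftInverse K H := fun p => Prod.ext rfl (hkg p.1 p.2)
  have hHK : Function.RightInverse K H := fun p => by
    obtain ⟨x', hx'⟩ := hrange' p
    have h1 : k p.1 p.2 = x' := congrArg TotalSpace.proj (hsymm p x' hx')
    have h2 : g (p.1, x') = (τ p.1).toMap p.2 := by
      rw [← (hτ p.1).symm_ψ p.2, ← hx']
    refine Prod.ext rfl ?_
    change (g (p.1, k p.1 p.2)).1 = p.2
    rw [h1, h2]
    rfl
  have hinj : ∀ p, Function.Injective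
      (mfderiv (𝓘(ℝ, ℝ).prod 𝓘(ℝ, F)) (𝓘(ℝ, ℝ).prod 𝓘(ℝ, F)) H p) := by
    rintro ⟨t, x⟩
    let D : ℝ × F →L[ℝ] ℝ × F :=
      mfderiv (𝓘(ℝ, ℝ).prod 𝓘(ℝ, F)) (𝓘(ℝ, ℝ).prod 𝓘(ℝ, F)) H (t, x)
    have hD : HasMFDerivAt (𝓘(ℝ, ℝ).prod 𝓘(ℝ, F)) (𝓘(ℝ, ℝ).prod 𝓘(ℝ, F)) H (t, x) D :=
      (hH.mdifferentiableAt (by simp)).hasMFDerivAt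
    have hfst : (ContinuousLinearMap.fst ℝ ℝ F).comp D = ContinuousLinearMap.fst ℝ ℝ F :=
      hasMFDerivAt_unique ((hasMFDerivAt_fst (I := 𝓘(ℝ, ℝ)) (I' := 𝓘(ℝ, F)) (H (t, x))).comp
        (t, x) hD) (hasMFDerivAt_fst (t, x))
    -- For fixed `t`, the map `k_t` is a smooth left inverse of `h_t`.
    have hsnd : ∃ B : ℝ × F →L[ℝ] F, ∀ v, B (D (0, v)) = v := by
      let P : ℝ × L → L := fun p => k t p.2
      have hP : ContMDiff (𝓘(ℝ, ℝ).prod 𝓘(ℝ, F)) 𝓘(ℝ, F) ∞ P := (hk t).comp contMDiff_snd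
      have hP' := (hP.mdifferentiableAt (x := H (t, x)) (by simp)).hasMFDerivAt
      have hi : HasMFDerivAt 𝓘(ℝ, F) (𝓘(ℝ, ℝ).prod 𝓘(ℝ, F)) (fun y : L => (t, y)) x
          (ContinuousLinearMap.inr ℝ ℝ F) :=
        (hasMFDerivAt_const t x).prodMk (hasMFDerivAt_id x)
      have hPHi := (hP'.comp (t, x) hD).comp x hi
      have hid : (P ∘ H) ∘ (fun y : L => (t, y)) = id := funext fun y => hkg t y
      rw [hid] at hPHi
      have heq := hasMFDerivAt_unique hPHi (hasMFDerivAt_id x)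
      exact ⟨mfderiv (𝓘(ℝ, ℝ).prod 𝓘(ℝ, F)) 𝓘(ℝ, F) P (H (t, x)),
        fun v => congrArg (fun A : F →L[ℝ] F => A v) heq⟩
    obtain ⟨B, hB⟩ := hsnd
    have hker : ∀ w : ℝ × F, D w = 0 → w = 0 := by
      rintro ⟨a, v⟩ hw
      have ha : a = 0 := by
        have := congrArg (fun A : ℝ × F →L[ℝ] ℝ => A (a, v)) hfst
        simpa [hw] using this.symm
      subst ha
      have hv := hB v
      rw [hw, map_zero] at hv
      rw [← hv]
      rfl
    exact (injective_iff_map_eq_zero D).2 hker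
  have hK := contMDiff_inverse hH hinj hKH hHK
  refine (hg.comp hK).congr fun p => ?_
  have h1 := hgτ (K p)
  have h2 : (g (K p)).1 = p.2 := congrArg Prod.snd (hHK p)
  rw [h2] at h1
  exact h1

end LagrangianNeighborhood

end Sections

/-! ### The two equivalence relations -/

section Relations

variable {E : Type*} [NormedAddCommGroup E] [NormedSpace ℝ E]
  {M : Type*} [TopologicalSpace M] [ChartedSpace E M]
  {F : Type*} [NormedAddCommGroup F] [NormedSpace ℝ F]
  {L : Type*} [TopologicalSpace L] [ChartedSpace F L]

theorem pullback_trans {k : ℕ} (φ φ' : M ≃ₘ^∞⟮𝓘(ℝ, E), 𝓘(ℝ, E)⟯ M) (α : DiffForm 𝓘(ℝ, E) M k) :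
    (α.pullback (φ.trans φ') : DiffForm 𝓘(ℝ, E) M k) =
      DiffForm.pullback φ (α.pullback φ' : DiffForm 𝓘(ℝ, E) M k) := by
  rw [Diffeomorph.coe_trans]
  exact α.pullback_comp (φ.mdifferentiable (by simp)) (φ'.mdifferentiable (by simp))

theorem pullback_of_apply_eq {k : ℕ} {φ : M → M} (hφ : ∀ x, φ x = x) (α : DiffForm 𝓘(ℝ, E) M k) :
    (α.pullback φ : DiffForm 𝓘(ℝ, E) M k) = α := by
  obtain rfl : φ = fun x => x := funext hφ
  exact α.pullback_id

theorem pullback_symm_pullback {k : ℕ} (φ : M ≃ₘ^∞⟮𝓘(ℝ, E), 𝓘(ℝ, E)⟯ M)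
    (α : DiffForm 𝓘(ℝ, E) M k) :
    (DiffForm.pullback φ.symm (α.pullback φ : DiffForm 𝓘(ℝ, E) M k) : DiffForm 𝓘(ℝ, E) M k) =
      α := by
  rw [← pullback_trans]
  exact pullback_of_apply_eq (by simp) α

theorem DefL.Equiv.of_form_eq {ι : L → M} {η η' : DefL E F ι} (h : η.form.form = η'.form.form) :
    η.Equiv η' :=
  ⟨_, IsIsotopy.refl, (pullback_of_apply_eq (fun _ => rfl) _).trans h.symm, fun _ _ => image_id _⟩

theorem equivalence_defL {ι : L → M} :
    Equivalence (DefL.Equiv (E := E) (F := F) (ι := ι)) where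
  refl η := .of_form_eq rfl
  symm := by
    rintro η η' ⟨ρ, hρ, hform, hL⟩
    have h1 : (ρ 1).symm '' range ι = range ι := by
      conv_lhs => rw [← hL 1 (right_mem_Icc.2 zero_le_one), ← image_comp]
      simp
    refine ⟨_, hρ.symm, ?_, fun t ht => ?_⟩
    · rw [pullback_trans, pullback_of_apply_eq (φ := ρ (1 - 1)) (by simpa using hρ.zero), ← hform,
        pullback_symm_pullback]
    · rw [Diffeomorph.coe_trans, image_comp, h1]
      exact hL _ ⟨by linarith [ht.2], by linarith [ht.1]⟩
  trans := by
    rintro η η' η'' ⟨ρ, hρ, hform, hL⟩ ⟨ρ', hρ', hform', hL'⟩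
    refine ⟨_, hρ.trans hρ', ?_, fun t _ => ?_⟩
    · rw [pullback_trans, Real.smoothTransition.one_of_one_le (by norm_num),
        Real.smoothTransition.one_of_one_le (by norm_num), hform', hform]
    · rw [Diffeomorph.coe_trans, image_comp, hL _ (smoothTransition_mem_Icc _),
        hL' _ (smoothTransition_mem_Icc _)]

variable [IsManifold 𝓘(ℝ, F) ∞ L] {Ω : SymplecticForm E M} {ι : L → M}
  (𝒩 : LagrangianNeighborhood (F := F) Ω ι)

theorem equivalence_pairs : Equivalence (LagrangianNeighborhood.Pairs.Equiv 𝒩) where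
  refl p := ⟨_, IsIsotopy.refl, image_id _, pullback_of_apply_eq (fun _ => rfl) _, fun t _ => by
    change id '' _ ∈ _
    rw [image_id]
    exact p.sub.2⟩
  symm := by
    rintro p p' ⟨φ, hφ, him, hform, hmem⟩
    have h1 : (φ 1).symm '' (p'.sub : Set M) = p.sub := by
      rw [← him, ← image_comp]
      simp
    refine ⟨_, hφ.symm, ?_, ?_, fun t ht => ?_⟩
    · rw [Diffeomorph.coe_trans, image_comp, h1, sub_self, funext hφ.zero]
      simp
    · rw [pullback_trans, pullback_of_apply_eq (φ := φ (1 - 1)) (by simpa using hφ.zero), ← hform,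
        pullback_symm_pullback]
    · rw [Diffeomorph.coe_trans, image_comp, h1]
      exact hmem _ ⟨by linarith [ht.2], by linarith [ht.1]⟩
  trans := by
    rintro p p' p'' ⟨φ, hφ, him, hform, hmem⟩ ⟨φ', hφ', him', hform', hmem'⟩
    refine ⟨_, hφ.trans hφ', ?_, ?_, fun t _ => ?_⟩
    · rw [Diffeomorph.coe_trans, Real.smoothTransition.one_of_one_le (by norm_num),
        Real.smoothTransition.one_of_one_le (by norm_num), image_comp, him, him']
    · rw [pullback_trans, Real.smoothTransition.one_of_one_le (by norm_num),
        Real.smoothTransition.one_of_one_le (by norm_num), hform', hform]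
    · rcases hφ'.trans_cases (φ := φ) t with h | h
      · rw [h]
        exact hmem _ (smoothTransition_mem_Icc _)
      · rw [h, image_comp, him]
        exact hmem' _ (smoothTransition_mem_Icc _)

end Relations

/-! ### The map `q` and its descent to equivalence classes -/

section Descent

variable {E : Type*} [NormedAddCommGroup E] [NormedSpace ℝ E]
  {M : Type*} [TopologicalSpace M] [ChartedSpace E M] [CompactSpace M]
  {F : Type*} [NormedAddCommGroup F] [NormedSpace ℝ F] [FiniteDimensional ℝ F]
  {L : Type*} [TopologicalSpace L] [ChartedSpace F L] [IsManifold 𝓘(ℝ, F) ∞ L] [T2Space L]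
  {Ω : SymplecticForm E M} {ι : L → M}

namespace LagrangianNeighborhood

variable (𝒩 : LagrangianNeighborhood (F := F) Ω ι)

/-- `φ_{L'}` as a diffeomorphism, with inverse the flow of `-σ`. -/
def phiDiffeo (L' : 𝒩.chartNhd) : M ≃ₘ^∞⟮𝓘(ℝ, E), 𝓘(ℝ, E)⟯ M := 𝒩.flowDiffeo (𝒩.sectionOf L')

theorem image_phiDiffeo (L' : 𝒩.chartNhd) : 𝒩.phiDiffeo L' '' range ι = L' :=
  𝒩.image_flowMap (represents_sectionOf L')

variable [FiniteDimensional ℝ E] [IsManifold 𝓘(ℝ, E) ∞ M]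

/-- The map `q(ω', L') = φ_{L'}^* ω'`. -/
def transport (p : 𝒩.Pairs) : DefL E F ι where
  form := p.form.pullback (𝒩.phiDiffeo p.sub)
  lagrangian := IsLagrangianSubmanifold.of_image (𝒩.phiDiffeo p.sub) rfl (by
    rw [image_phiDiffeo]
    exact p.lagrangian)

theorem transport_form (p : 𝒩.Pairs) :
    (𝒩.transport p).form.form = DiffForm.pullback (𝒩.phiDiffeo p.sub) p.form.form := rfl

/-- Equivalent pairs have equivalent images: the isotopy `φ_t` from `(ω', L')` to `(ω'', L'')` is
conjugated to `φ_{L_t}⁻¹ ∘ φ_t ∘ φ_{L'}` with `L_t = φ_t(L')`, which preserves `L`. -/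
theorem transport_equiv {p p' : 𝒩.Pairs} (h : Pairs.Equiv 𝒩 p p') :
    (𝒩.transport p).Equiv (𝒩.transport p') := by
  obtain ⟨φ, hφ, him, hform, hmem⟩ := h
  let β := Real.smoothTransition
  let L' : ℝ → 𝒩.chartNhd := fun t => ⟨φ (β t) '' p.sub, hmem _ (smoothTransition_mem_Icc t)⟩
  have hL0 : L' 0 = p.sub := Subtype.ext (by
    change φ (β 0) '' _ = _
    rw [show β 0 = 0 from Real.smoothTransition.zero, funext hφ.zero]
    simp)
  have hφ1 : φ (β 1) = φ 1 := congrArg φ Real.smoothTransition.one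
  have hL1 : L' 1 = p'.sub := Subtype.ext (by
    change φ (β 1) '' _ = _
    rw [hφ1, him])
  have hsec := Represents.contMDiff_family (𝒩 := 𝒩) hφ.contMDiff_smoothTransition
    (represents_sectionOf p.sub) (τ := fun t => 𝒩.sectionOf (L' t))
    fun t => represents_sectionOf (L' t)
  have hneg : ContMDiff (𝓘(ℝ, ℝ).prod 𝓘(ℝ, F)) (cotangentModel F) ∞
      (fun q : ℝ × L => (-𝒩.sectionOf (L' q.1)).toMap q.2) := by
    -- `-σ = σ + (-2) σ`
    refine (contMDiff_add_smul (c := fun _ => -2) hsec hsec contMDiff_const).congr fun q => ?_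
    refine congrArg (TotalSpace.mk q.2) ?_
    change -(𝒩.sectionOf (L' q.1) q.2) = _
    module
  refine ⟨fun t => ((𝒩.phiDiffeo p.sub).trans (φ (β t))).trans (𝒩.phiDiffeo (L' t)).symm,
    ⟨?_, fun x => ?_⟩, ?_, fun t _ => ?_⟩
  · have h1 : ContMDiff (𝓘(ℝ, ℝ).prod 𝓘(ℝ, E)) 𝓘(ℝ, E) ∞
        (fun q : ℝ × M => φ (β q.1) (𝒩.phiDiffeo p.sub q.2)) :=
      hφ.contMDiff_smoothTransition.comp (contMDiff_fst.prodMk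
        ((𝒩.phiDiffeo p.sub).contMDiff.comp contMDiff_snd))
    exact ((𝒩.contMDiff_flowMap (S := fun t => -𝒩.sectionOf (L' t)) hneg).comp
      (contMDiff_fst.prodMk h1)).contMDiffOn
  · change (𝒩.phiDiffeo (L' 0)).symm (φ (β 0) (𝒩.phiDiffeo p.sub x)) = x
    rw [hL0, show β 0 = 0 from Real.smoothTransition.zero, hφ.zero, Diffeomorph.symm_apply_apply]
  · rw [transport_form, transport_form, pullback_trans, pullback_trans, hL1,
      pullback_symm_pullback, hφ1, hform]
  · have h1 : φ (β t) '' (p.sub : Set M) = 𝒩.phiDiffeo (L' t) '' range ι :=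
      (𝒩.image_phiDiffeo (L' t)).symm
    rw [Diffeomorph.coe_trans, Diffeomorph.coe_trans, image_comp, image_comp, image_phiDiffeo, h1,
      ← image_comp]
    simp

/-- Pairs with equivalent images are equivalent: an isotopy `ρ_t` that preserves `L` is conjugated
to `φ_{L_t} ∘ ρ_t ∘ φ_{L'}⁻¹`, where `L_t` is the image of `(1 - t) σ' + t σ''`, which moves `L'`
to `L_t`. -/
theorem equiv_of_transport_equiv {p p' : 𝒩.Pairs}
    (h : (𝒩.transport p).Equiv (𝒩.transport p')) : Pairs.Equiv 𝒩 p p' := by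
  obtain ⟨ρ, hρ, hform, hL⟩ := h
  let σ := 𝒩.sectionOf p.sub
  let σ' := 𝒩.sectionOf p'.sub
  let S : ℝ → OneForm F L := fun t => σ + t • (σ' - σ)
  have hS0 : S 0 = σ := ContMDiffSection.ext fun x => by
    change σ x + (0 : ℝ) • (σ' x - σ x) = σ x
    module
  have hS1 : S 1 = σ' := ContMDiffSection.ext fun x => by
    change σ x + (1 : ℝ) • (σ' x - σ x) = σ' x
    module
  have him : ∀ t ∈ Icc (0 : ℝ) 1,
      (((𝒩.phiDiffeo p.sub).symm.trans (ρ t)).trans (𝒩.flowDiffeo (S t)) : M → M) '' p.sub =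
        range fun x => 𝒩.ψ ((S t).toMap x) := fun t ht => by
    have h1 : (𝒩.phiDiffeo p.sub).symm '' (p.sub : Set M) = range ι := by
      conv_lhs => rw [← 𝒩.image_phiDiffeo p.sub, ← image_comp]
      simp
    rw [Diffeomorph.coe_trans, Diffeomorph.coe_trans, image_comp, image_comp, h1, hL t ht]
    exact 𝒩.image_flowMap ⟨(represents_sectionOf p.sub).segment (represents_sectionOf p'.sub) ht,
      rfl⟩
  refine ⟨fun t => ((𝒩.phiDiffeo p.sub).symm.trans (ρ t)).trans (𝒩.flowDiffeo (S t)),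
    ⟨?_, fun x => ?_⟩, ?_, ?_, fun t ht => ?_⟩
  · refine (𝒩.contMDiff_flowMap
      (contMDiff_section_add_smul σ (σ' - σ) contDiff_id)).comp_contMDiffOn
      (contMDiffOn_fst.prodMk (hρ.smooth.comp (g := fun q : ℝ × M => ρ q.1 q.2)
        (f := fun q : ℝ × M => (q.1, (𝒩.phiDiffeo p.sub).symm q.2)) ?_ ?_))
    · exact (contMDiff_fst.prodMk
        ((𝒩.phiDiffeo p.sub).symm.contMDiff.comp contMDiff_snd)).contMDiffOn
    · exact fun q hq => ⟨hq.1, mem_univ _⟩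
  · change 𝒩.flowDiffeo (S 0) (ρ 0 ((𝒩.phiDiffeo p.sub).symm x)) = x
    rw [hS0, hρ.zero]
    exact (𝒩.phiDiffeo p.sub).apply_symm_apply x
  · rw [him 1 (right_mem_Icc.2 zero_le_one), hS1]
    exact (represents_sectionOf p'.sub).2
  · rw [transport_form, transport_form] at hform
    rw [pullback_trans, pullback_trans, hS1]
    change DiffForm.pullback _ (DiffForm.pullback (ρ 1)
      (DiffForm.pullback (𝒩.phiDiffeo p'.sub) p'.form.form)) = _
    rw [hform, pullback_symm_pullback]
  · rw [him t ht]
    exact ⟨S t, (represents_sectionOf p.sub).segment (represents_sectionOf p'.sub) ht, rfl⟩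

/-- A form `η ∈ Def_L(ω)` is the image of `(η, L)`, since `φ_L = id`. -/
theorem exists_transport_equiv (η : DefL E F ι) : ∃ p : 𝒩.Pairs, (𝒩.transport p).Equiv η := by
  let L₀ : 𝒩.chartNhd := ⟨range ι, 0, 𝒩.represents_zero⟩
  refine ⟨⟨η.form, L₀, η.lagrangian⟩, .of_form_eq (pullback_of_apply_eq (fun x => ?_) _)⟩
  have h0 : 𝒩.sectionOf L₀ = 0 := Represents.sectionOf_eq 𝒩.represents_zero
  change 𝒩.flowMap (𝒩.sectionOf L₀) x = x
  rw [h0, flowMap_zero]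

end LagrangianNeighborhood

end Descent

end LagDeform

end

theorem mainTheorem2
    {E : Type*} [NormedAddCommGroup E] [NormedSpace ℝ E] [FiniteDimensional ℝ E]
    {M : Type*} [TopologicalSpace M] [ChartedSpace E M] [IsManifold 𝓘(ℝ, E) ∞ M]
    [CompactSpace M] [T2Space M]
    {F : Type*} [NormedAddCommGroup F] [NormedSpace ℝ F] [FiniteDimensional ℝ F]
    {L : Type*} [TopologicalSpace L] [ChartedSpace F L] [IsManifold 𝓘(ℝ, F) ∞ L]
    [CompactSpace L] [T2Space L]
    (Ω : LagDeform.SymplecticForm E M) (ι : L → M)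
    (hι : LagDeform.IsLagrangianEmbedding (F := F) Ω ι)
    (𝒩 : LagDeform.LagrangianNeighborhood (F := F) Ω ι) :
    -- `φ_{L'}` is well defined, isotopic to the identity, and moves `L` to `L'`
    (∀ L' : 𝒩.chartNhd,
      (∃! σ : LagDeform.OneForm F L, 𝒩.Represents σ (L' : Set M)) ∧
      LagDeform.IsTimeOneFlow (𝒩.field L') (𝒩.phi L') ∧
      (∃ ρ : ℝ → (M ≃ₘ^∞⟮𝓘(ℝ, E), 𝓘(ℝ, E)⟯ M),
        LagDeform.IsIsotopy ρ ∧ ⇑(ρ 1) = 𝒩.phi L') ∧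
      𝒩.phi L' '' range ι = L') ∧
    -- both relations are equivalence relations
    Equivalence (LagDeform.LagrangianNeighborhood.Pairs.Equiv 𝒩) ∧
    Equivalence (LagDeform.DefL.Equiv (E := E) (F := F) (ι := ι)) ∧
    -- `q(ω', L') = φ_{L'}^* ω'` takes values in `Def_L(ω)` and descends to a bijection
    ∃ q : 𝒩.Pairs → LagDeform.DefL E F ι,
      (∀ p : 𝒩.Pairs,
        (q p).form.form = LagDeform.DiffForm.pullback (𝒩.phi p.sub) p.form.form) ∧
      ∃ qbar : Quot (LagDeform.LagrangianNeighborhood.Pairs.Equiv 𝒩) →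
          Quot (LagDeform.DefL.Equiv (E := E) (F := F) (ι := ι)),
        (∀ p : 𝒩.Pairs, qbar (Quot.mk _ p) = Quot.mk _ (q p)) ∧
        Function.Bijective qbar := by
  have hphi : ∀ L', 𝒩.phi L' = 𝒩.phiDiffeo L' := 𝒩.phi_eq_flowMap
  have hdef := LagDeform.equivalence_defL (E := E) (F := F) (ι := ι)
  refine ⟨fun L' => ⟨⟨_, LagDeform.LagrangianNeighborhood.represents_sectionOf L', fun τ hτ =>
      (LagDeform.LagrangianNeighborhood.Represents.sectionOf_eq hτ).symm⟩, fun y => ?_, ?_, ?_⟩,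
    LagDeform.equivalence_pairs 𝒩, hdef, 𝒩.transport, fun p => ?_,
    Quot.map 𝒩.transport fun p p' => 𝒩.transport_equiv, fun p => rfl, ?_, ?_⟩
  · refine ⟨_, 𝒩.flowMap_zero_smul (𝒩.sectionOf L') y, 𝒩.isMIntegralCurve_flowMap _ y, ?_⟩
    rw [hphi]
    exact congrArg (fun τ => 𝒩.flowMap τ y) (ContMDiffSection.ext fun x => one_smul ℝ _)
  · refine ⟨_, 𝒩.isIsotopy_flowDiffeo (𝒩.sectionOf L'), ?_⟩
    rw [hphi]
    exact congrArg 𝒩.flowMap (ContMDiffSection.ext fun x => one_smul ℝ _)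
  · rw [hphi, 𝒩.image_phiDiffeo]
  · rw [hphi, 𝒩.transport_form]
  · rintro ⟨p⟩ ⟨p'⟩ h
    have h1 : (𝒩.transport p).Equiv (𝒩.transport p') :=
      hdef.eqvGen_iff.1 (Quot.eqvGen_exact h)
    exact Quot.sound (𝒩.equiv_of_transport_equiv h1)
  · rintro ⟨η⟩
    obtain ⟨p, hp⟩ := 𝒩.exists_transport_equiv η
    exact ⟨Quot.mk _ p, Quot.sound hp⟩
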